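/- Let $k$ be a field and let $(V,c)$ be a finite dimensional braided vector space over $k$, i.e. $c$ is a linear automorphism of $V\otimes V$ with $(c\otimes\mathrm{id})(\mathrm{id}\otimes c)(c\otimes\mathrm{id})=(\mathrm{id}\otimes c)(c\otimes\mathrm{id})(\mathrm{id}\otimes c)$. Assume that $c$ is left triangular with respect to a totally ordered basis $X$ of $V$: for all $x,y\in X$ $$c(x\otimes y)=\gamma_{x,y}\,y\otimes x+\sum_{z>y} z\otimes v_{x,y,z}\qquad\text{with } \gamma_{x,y}\in k,\ v_{x,y,z}\in V .$$ Let $d$ be the diagonal component of $c$, $d(x\otimes y)=\gamma_{x,y}\,y\otimes x$ for $x,y\in X$. An endomorphism $r$ of $V\otimes V$ is extended to $T(V)\otimes T(V)$ by maps $r_{n,m}:V^{\otimes n}\otimes V^{\otimes m}\to V^{\otimes m}\otimes V^{\otimes n}$, where $r_{n,0}$ and $r_{0,m}$ are identities, $r_{1,1}=r$, $r_{1,m+1}=(\mathrm{id}\otimes r_{1,m})(r\otimes\mathrm{id})$ and $r_{n+1,m}=(r_{n,m}\otimes\mathrm{id})(\mathrm{id}\otimes r_{1,m})$. Identify the tensor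 algebra $T(V)$ with the free algebra $k\langle X\rangle$. It is a braided bialgebra with the braiding extending $c$: $\varepsilon$ is the algebra map with $\varepsilon(x)=0$, and $\Delta$ the algebra map with $\Delta(x)=x\otimes1+1\otimes x$ for $x\in V$, where $T(V)\otimes T(V)$ has the product $(m\otimes m)(\mathrm{id}\otimes c\otimes\mathrm{id})$. A braided biideal is a two-sided ideal $I$ of $T(V)$ with $\Delta(I)\subset J$, $\varepsilon(I)=0$ and $c(J)=J$, where $J=T(V)\otimes I+I\otimes T(V)$. Let $I\subsetneq T(V)$ be a braided biideal. Order the words in $X$ lexicographically, a proper beginning of a word being smaller than the word. A nonempty word is a Lyndon word if it is smaller than each of its proper nonempty endings. For words $u,w$ write $w\succ u$ if $w$ is shorter than $u$, or if $w$ and $u$ have the same length and $w>u$ lexicographically, and let $k\langle X\rangle_{\succ u}$ be the span of all words $w\succ u$. Put $$S_I=\{u \mid u \text{ a Lyndon word},\ u\notin k\langle X\rangle_{\succ u}+I\},\qquad h_I(u)=\min\{t\ge 1\mid u^t\in k\langle X\rangle_{\succ u^t}+I\}\quad(u\in S_I),$$ with $h_I(u)=\infty$ if there is no such $t$. Let $v\in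 S_I$. For words $u,w$ let $\gamma_{u,w}$ be the product of all $\gamma_{x,y}$ with $x$ running over the letters of $u$ and $y$ over the letters of $w$ (with multiplicity). Then $d(v\otimes v)=\gamma_{v,v}\,v\otimes v$ for the extension of $d$ to $T(V)\otimes T(V)$. If $h:=h_I(v)<\infty$, then $\gamma_{v,v}$ is a root of unity; let $t\ge1$ be its order. If $\operatorname{char}k=0$, then $\gamma_{v,v}\neq1$ and $h=t$. If $\operatorname{char}k=p>0$, then $h=t\,p^l$ for some integer $l\ge0$. -/

import Mathlib

open scoped TensorProduct

noncomputable section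

namespace BraidedPBW

section Braiding

variable {k V : Type*} [Field k] [AddCommGroup V] [Module k V]

/-- The braid equation
`(r ⊗ id) (id ⊗ r) (r ⊗ id) = (id ⊗ r) (r ⊗ id) (id ⊗ r)` on `V ⊗ V ⊗ V`. A braided vector space
is a vector space with an automorphism `c` of `V ⊗ V` satisfying this equation. -/
def BraidEquation (r : V ⊗[k] V →ₗ[k] V ⊗[k] V) : Prop :=
  let r₁₂ : (V ⊗[k] V) ⊗[k] V →ₗ[k] (V ⊗[k] V) ⊗[k] V := r.rTensor V
  let r₂₃ : (V ⊗[k] V) ⊗[k] V →ₗ[k] (V ⊗[k] V) ⊗[k] V :=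
    (TensorProduct.assoc k V V V).symm.toLinearMap ∘ₗ r.lTensor V ∘ₗ
      (TensorProduct.assoc k V V V).toLinearMap
  r₁₂ ∘ₗ r₂₃ ∘ₗ r₁₂ = r₂₃ ∘ₗ r₁₂ ∘ₗ r₂₃

/-- For `y : V`, the operator `a ⊗ x ↦ a · r (x ⊗ y)` on `T(V) ⊗ V`. -/
def stepRight (r : V ⊗[k] V →ₗ[k] V ⊗[k] V) :
    V →ₗ[k] Module.End k (TensorAlgebra k V ⊗[k] V) :=
  LinearMap.flip <| TensorProduct.lift <| LinearMap.mk₂ k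
    (fun (a : TensorAlgebra k V) (x : V) =>
      (TensorProduct.map (LinearMap.mulLeft k a ∘ₗ TensorAlgebra.ι k) LinearMap.id) ∘ₗ r ∘ₗ
        TensorProduct.mk k V V x)
    (fun a a' x => by
      ext y
      simp only [LinearMap.coe_comp, Function.comp_apply, LinearMap.add_apply]
      induction r (TensorProduct.mk k V V x y) with
      | zero => simp
      | tmul p q => simp [add_mul, TensorProduct.add_tmul]
      | add p q hp hq => simp only [map_add, hp, hq]; abel)
    (fun s a x => by
      ext y
      simp only [LinearMap.coe_comp, Function.comp_apply, LinearMap.smul_apply]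
      induction r (TensorProduct.mk k V V x y) with
      | zero => simp
      | tmul p q => simp [TensorProduct.smul_tmul']
      | add p q hp hq => simp only [map_add, hp, hq, smul_add])
    (fun a x x' => by ext y; simp)
    (fun s a x => by ext y; simp)

/-- The maps `r_{1,m} : V ⊗ V^{⊗ m} → V^{⊗ m} ⊗ V`, assembled over all `m` into a map
`x ↦ (w ↦ r (x ⊗ w))`, `V → Hom (T(V), T(V) ⊗ V)`. -/
def crossOne (r : V ⊗[k] V →ₗ[k] V ⊗[k] V) :
    V →ₗ[k] TensorAlgebra k V →ₗ[k] TensorAlgebra k V ⊗[k] V :=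
  LinearMap.flip <|
    (LinearMap.lcomp k (TensorAlgebra k V ⊗[k] V) (TensorProduct.mk k (TensorAlgebra k V) V 1)) ∘ₗ
      (MulOpposite.opLinearEquiv k).symm.toLinearMap ∘ₗ
      (TensorAlgebra.lift k ((MulOpposite.opLinearEquiv k).toLinearMap ∘ₗ stepRight r)).toLinearMap

/-- For `x : V`, the operator `w ⊗ a ↦ r (x ⊗ w) · (1 ⊗ a)` on `T(V) ⊗ T(V)`. -/
def stepLeft (r : V ⊗[k] V →ₗ[k] V ⊗[k] V) :
    V →ₗ[k] Module.End k (TensorAlgebra k V ⊗[k] TensorAlgebra k V) :=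
  (LinearMap.llcomp k (TensorAlgebra k V ⊗[k] TensorAlgebra k V)
      ((TensorAlgebra k V ⊗[k] V) ⊗[k] TensorAlgebra k V)
      (TensorAlgebra k V ⊗[k] TensorAlgebra k V)
      (((LinearMap.mul' k (TensorAlgebra k V)) ∘ₗ
        (TensorAlgebra.ι k).rTensor (TensorAlgebra k V)).lTensor (TensorAlgebra k V) ∘ₗ
        (TensorProduct.assoc k (TensorAlgebra k V) V (TensorAlgebra k V)).toLinearMap)) ∘ₗ
    LinearMap.rTensorHom (TensorAlgebra k V) ∘ₗ crossOne r

/-- The extension of an endomorphism `r` of `V ⊗ V` to an endomorphism of `T(V) ⊗ T(V)`,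
made of the maps `r_{n,m} : V^{⊗ n} ⊗ V^{⊗ m} → V^{⊗ m} ⊗ V^{⊗ n}`. The inductive description
of these maps is given by the lemmas `extend_one_left`, `extend_one_right`, `extend_ι_ι`,
`extend_ι_mul`, `extend_mul_ι` below. -/
def extend (r : V ⊗[k] V →ₗ[k] V ⊗[k] V) :
    TensorAlgebra k V ⊗[k] TensorAlgebra k V →ₗ[k] TensorAlgebra k V ⊗[k] TensorAlgebra k V :=
  TensorProduct.lift <|
    (LinearMap.lcomp k (TensorAlgebra k V ⊗[k] TensorAlgebra k V)
      ((TensorProduct.mk k (TensorAlgebra k V) (TensorAlgebra k V)).flip 1)) ∘ₗ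
      (TensorAlgebra.lift k (stepLeft r)).toLinearMap

/-- The multiplication `(m ⊗ m) (id ⊗ c ⊗ id)` of the braided tensor square of `T(V)`. -/
def twistedMul (c : V ⊗[k] V →ₗ[k] V ⊗[k] V) :
    (TensorAlgebra k V ⊗[k] TensorAlgebra k V) ⊗[k] (TensorAlgebra k V ⊗[k] TensorAlgebra k V)
      →ₗ[k] TensorAlgebra k V ⊗[k] TensorAlgebra k V :=
  let T := TensorAlgebra k V
  TensorProduct.map (LinearMap.mul' k T) (LinearMap.mul' k T) ∘ₗ
    (TensorProduct.assoc k T T (T ⊗[k] T)).symm.toLinearMap ∘ₗ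
    ((TensorProduct.assoc k T T T).toLinearMap ∘ₗ (extend c).rTensor T ∘ₗ
      (TensorProduct.assoc k T T T).symm.toLinearMap).lTensor T ∘ₗ
    (TensorProduct.assoc k T T (T ⊗[k] T)).toLinearMap

/-- The comultiplication of `T(V)`: the algebra homomorphism from `T(V)` to the braided tensor
square of `T(V)` with `x ↦ x ⊗ 1 + 1 ⊗ x` for `x` in `V`. It is given by
`Δ (x₁ ⋯ xₙ) = Δ x₁ · (Δ x₂ · ( ⋯ (Δ xₙ · (1 ⊗ 1))))`, with products in the braided tensor
square. -/
def comul (c : V ⊗[k] V →ₗ[k] V ⊗[k] V) :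
    TensorAlgebra k V →ₗ[k] TensorAlgebra k V ⊗[k] TensorAlgebra k V :=
  LinearMap.applyₗ ((1 : TensorAlgebra k V) ⊗ₜ[k] (1 : TensorAlgebra k V)) ∘ₗ
    (TensorAlgebra.lift k
      ((TensorProduct.curry (twistedMul c) :
          TensorAlgebra k V ⊗[k] TensorAlgebra k V →ₗ[k]
            Module.End k (TensorAlgebra k V ⊗[k] TensorAlgebra k V)) ∘ₗ
        ((TensorProduct.mk k (TensorAlgebra k V) (TensorAlgebra k V)).flip 1 +
          TensorProduct.mk k (TensorAlgebra k V) (TensorAlgebra k V) 1) ∘ₗ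
        TensorAlgebra.ι k)).toLinearMap

/-- The counit of `T(V)`: the algebra homomorphism with `x ↦ 0` for `x` in `V`. -/
def counit : TensorAlgebra k V →ₐ[k] k := TensorAlgebra.lift k 0

/-- The subspace `T(V) ⊗ I + I ⊗ T(V)` of `T(V) ⊗ T(V)`. -/
def tensorIdeal (I : Ideal (TensorAlgebra k V)) :
    Submodule k (TensorAlgebra k V ⊗[k] TensorAlgebra k V) :=
  LinearMap.range ((I.restrictScalars k).subtype.lTensor (TensorAlgebra k V)) ⊔
    LinearMap.range ((I.restrictScalars k).subtype.rTensor (TensorAlgebra k V))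

/-- `I` is a braided biideal of `T(V, c)`. -/
structure IsBraidedBiideal (c : V ⊗[k] V →ₗ[k] V ⊗[k] V) (I : Ideal (TensorAlgebra k V)) :
    Prop where
  isTwoSided : I.IsTwoSided
  comul_mem : ∀ a ∈ I, comul c a ∈ tensorIdeal I
  counit_eq_zero : ∀ a ∈ I, counit a = 0
  map_extend : (tensorIdeal I).map (extend c) = tensorIdeal I

/-! ### The inductive description of the extended braiding and of the comultiplication -/

lemma stepRight_tmul (r : V ⊗[k] V →ₗ[k] V ⊗[k] V) (y : V) (a : TensorAlgebra k V) (x : V) :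
    stepRight r y (a ⊗ₜ x) =
      TensorProduct.map (LinearMap.mulLeft k a ∘ₗ TensorAlgebra.ι k) LinearMap.id
        (r (x ⊗ₜ y)) := rfl

lemma crossOne_one (r : V ⊗[k] V →ₗ[k] V ⊗[k] V) (x : V) : crossOne r x 1 = 1 ⊗ₜ x := by
  simp [crossOne]

lemma stepLeft_tmul (r : V ⊗[k] V →ₗ[k] V ⊗[k] V) (x : V) (w a : TensorAlgebra k V) :
    stepLeft r x (w ⊗ₜ a) =
      TensorProduct.map LinearMap.id (LinearMap.mulRight k a ∘ₗ TensorAlgebra.ι k)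
        (crossOne r x w) := by
  simp only [stepLeft, LinearMap.coe_comp, Function.comp_apply, LinearMap.llcomp_apply,
    LinearMap.coe_rTensorHom, LinearMap.rTensor_tmul, LinearEquiv.coe_coe]
  induction crossOne r x w with
  | zero => simp
  | tmul p q => simp
  | add p q hp hq => simp only [TensorProduct.add_tmul, map_add, hp, hq]

lemma extend_ι_left (r : V ⊗[k] V →ₗ[k] V ⊗[k] V) (x : V) (w : TensorAlgebra k V) :
    extend r (TensorAlgebra.ι k x ⊗ₜ w) = (TensorAlgebra.ι k).lTensor _ (crossOne r x w) := by
  have h := stepLeft_tmul r x w 1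
  simp only [extend, TensorProduct.lift.tmul, LinearMap.coe_comp, Function.comp_apply,
    AlgHom.toLinearMap_apply, LinearMap.lcomp_apply, TensorAlgebra.lift_ι_apply,
    LinearMap.flip_apply, TensorProduct.mk_apply, h, LinearMap.lTensor]
  congr 2
  ext; simp

lemma extend_one_left (r : V ⊗[k] V →ₗ[k] V ⊗[k] V) (w : TensorAlgebra k V) :
    extend r (1 ⊗ₜ w) = w ⊗ₜ 1 := by
  simp [extend]

lemma extend_ι_one (r : V ⊗[k] V →ₗ[k] V ⊗[k] V) (x : V) :
    extend r (TensorAlgebra.ι k x ⊗ₜ 1) = 1 ⊗ₜ TensorAlgebra.ι k x := by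
  simp [extend_ι_left, crossOne_one]

lemma stepRight_mulLeft (r : V ⊗[k] V →ₗ[k] V ⊗[k] V) (y : V) (a : TensorAlgebra k V)
    (z : TensorAlgebra k V ⊗[k] V) :
    stepRight r y ((LinearMap.mulLeft k a).rTensor V z) =
      (LinearMap.mulLeft k a).rTensor V (stepRight r y z) := by
  induction z with
  | zero => simp
  | tmul p q =>
    simp only [LinearMap.rTensor_tmul, stepRight_tmul, LinearMap.mulLeft_apply]
    induction r (q ⊗ₜ[k] y) with
    | zero => simp
    | tmul s t => simp [mul_assoc]
    | add s t hs ht => simp only [map_add, hs, ht]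
  | add p q hp hq => simp only [map_add, hp, hq]

/-- The product of the operators `stepRight`, taken in reverse order. -/
def crossOp (r : V ⊗[k] V →ₗ[k] V ⊗[k] V) :
    TensorAlgebra k V →ₐ[k] (Module.End k (TensorAlgebra k V ⊗[k] V))ᵐᵒᵖ :=
  TensorAlgebra.lift k ((MulOpposite.opLinearEquiv k).toLinearMap ∘ₗ stepRight r)

lemma crossOne_apply (r : V ⊗[k] V →ₗ[k] V ⊗[k] V) (x : V) (w : TensorAlgebra k V) :
    crossOne r x w = (crossOp r w).unop (1 ⊗ₜ x) := rfl

lemma crossOp_mulLeft (r : V ⊗[k] V →ₗ[k] V ⊗[k] V) (w a : TensorAlgebra k V)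
    (z : TensorAlgebra k V ⊗[k] V) :
    (crossOp r w).unop ((LinearMap.mulLeft k a).rTensor V z) =
      (LinearMap.mulLeft k a).rTensor V ((crossOp r w).unop z) := by
  induction w using TensorAlgebra.induction generalizing z with
  | algebraMap s => simp [AlgHom.commutes, MulOpposite.algebraMap_apply, Module.algebraMap_end_apply]
  | ι y => simp [crossOp, stepRight_mulLeft]
  | mul p q hp hq => simp [hp, hq]
  | add p q hp hq => simp [hp, hq]

/-- `c_{1,m+1} = (id ⊗ c_{1,m}) (c ⊗ id)`. -/
lemma extend_ι_mul (r : V ⊗[k] V →ₗ[k] V ⊗[k] V) (x y : V) (w : TensorAlgebra k V) :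
    extend r (TensorAlgebra.ι k x ⊗ₜ (TensorAlgebra.ι k y * w)) =
      ((LinearMap.mul' k (TensorAlgebra k V)).rTensor (TensorAlgebra k V) ∘ₗ
        (TensorProduct.assoc k _ _ _).symm.toLinearMap ∘ₗ
        (extend r).lTensor (TensorAlgebra k V) ∘ₗ
        (TensorProduct.assoc k _ _ _).toLinearMap)
        (TensorProduct.map (TensorAlgebra.ι k) (TensorAlgebra.ι k) (r (x ⊗ₜ y)) ⊗ₜ w) := by
  rw [extend_ι_left, crossOne_apply, map_mul, MulOpposite.unop_mul, Module.End.mul_apply]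
  have h1 : (crossOp r (TensorAlgebra.ι k y)).unop ((1 : TensorAlgebra k V) ⊗ₜ[k] x) =
      TensorProduct.map (TensorAlgebra.ι k) LinearMap.id (r (x ⊗ₜ y)) := by
    simp only [crossOp, TensorAlgebra.lift_ι_apply, LinearMap.coe_comp, Function.comp_apply,
      LinearEquiv.coe_coe, MulOpposite.coe_opLinearEquiv, MulOpposite.unop_op, stepRight_tmul]
    congr 2
    ext; simp
  rw [h1]
  induction r (x ⊗ₜ[k] y) with
  | zero => simp
  | tmul s t =>
    have h2 := crossOp_mulLeft r w (TensorAlgebra.ι k s) (1 ⊗ₜ t)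
    simp only [LinearMap.rTensor_tmul, LinearMap.mulLeft_apply, mul_one] at h2
    simp only [TensorProduct.map_tmul, LinearMap.id_apply, h2, ← crossOne_apply,
      LinearMap.coe_comp, Function.comp_apply, LinearEquiv.coe_coe, TensorProduct.assoc_tmul,
      LinearMap.lTensor_tmul, extend_ι_left]
    induction crossOne r t w with
    | zero => simp
    | tmul p q => simp
    | add p q hp hq => simp only [map_add, TensorProduct.tmul_add, hp, hq]
  | add s t hs ht => simp only [map_add, TensorProduct.add_tmul, hs, ht]

lemma extend_ι_ι (r : V ⊗[k] V →ₗ[k] V ⊗[k] V) (x y : V) :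
    extend r (TensorAlgebra.ι k x ⊗ₜ TensorAlgebra.ι k y) =
      TensorProduct.map (TensorAlgebra.ι k) (TensorAlgebra.ι k) (r (x ⊗ₜ y)) := by
  have h := extend_ι_mul r x y 1
  rw [mul_one] at h
  rw [h]
  induction r (x ⊗ₜ[k] y) with
  | zero => simp
  | tmul s t => simp [extend_ι_one]
  | add s t hs ht => simp only [map_add, TensorProduct.add_tmul, hs, ht]

lemma lift_stepLeft_mulRight (r : V ⊗[k] V →ₗ[k] V ⊗[k] V) (u a : TensorAlgebra k V)
    (z : TensorAlgebra k V ⊗[k] TensorAlgebra k V) :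
    TensorAlgebra.lift k (stepLeft r) u ((LinearMap.mulRight k a).lTensor _ z) =
      (LinearMap.mulRight k a).lTensor _ (TensorAlgebra.lift k (stepLeft r) u z) := by
  induction u using TensorAlgebra.induction generalizing z with
  | algebraMap s => simp [AlgHom.commutes, Module.algebraMap_end_apply]
  | ι y =>
    rw [TensorAlgebra.lift_ι_apply]
    induction z with
    | zero => simp
    | tmul p q =>
      simp only [LinearMap.lTensor_tmul, stepLeft_tmul, LinearMap.mulRight_apply]
      induction crossOne r y p with
      | zero => simp
      | tmul s t => simp
      | add s t hs ht => simp only [map_add, hs, ht]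
    | add p q hp hq => simp only [map_add, hp, hq]
  | mul p q hp hq => simp [hp, hq]
  | add p q hp hq => simp [hp, hq]

/-- `c_{n+1,m} = (c_{n,m} ⊗ id) (id ⊗ c_{1,m})`. -/
lemma extend_mul_ι (r : V ⊗[k] V →ₗ[k] V ⊗[k] V) (u : TensorAlgebra k V) (x : V)
    (w : TensorAlgebra k V) :
    extend r ((u * TensorAlgebra.ι k x) ⊗ₜ w) =
      ((LinearMap.mul' k (TensorAlgebra k V)).lTensor (TensorAlgebra k V) ∘ₗ
        (TensorProduct.assoc k _ _ _).toLinearMap ∘ₗ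
        (extend r).rTensor (TensorAlgebra k V) ∘ₗ
        (TensorProduct.assoc k _ _ _).symm.toLinearMap)
        (u ⊗ₜ extend r (TensorAlgebra.ι k x ⊗ₜ w)) := by
  have h (u w : TensorAlgebra k V) :
      extend r (u ⊗ₜ w) = TensorAlgebra.lift k (stepLeft r) u (w ⊗ₜ 1) := rfl
  rw [h, map_mul, Module.End.mul_apply, ← h]
  induction extend r (TensorAlgebra.ι k x ⊗ₜ[k] w) with
  | zero => simp
  | tmul s t =>
    have h2 := lift_stepLeft_mulRight r u t (s ⊗ₜ 1)
    simp only [LinearMap.lTensor_tmul, LinearMap.mulRight_apply, one_mul] at h2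
    rw [h2, ← h]
    simp only [LinearMap.coe_comp, Function.comp_apply, LinearEquiv.coe_coe,
      TensorProduct.assoc_symm_tmul, LinearMap.rTensor_tmul]
    induction extend r (u ⊗ₜ[k] s) with
    | zero => simp
    | tmul p q => simp
    | add p q hp hq => simp only [map_add, TensorProduct.add_tmul, hp, hq]
  | add s t hs ht => simp only [map_add, TensorProduct.tmul_add, hs, ht]

lemma extend_one_right (r : V ⊗[k] V →ₗ[k] V ⊗[k] V) (u : TensorAlgebra k V) :
    extend r (u ⊗ₜ 1) = 1 ⊗ₜ u := by
  have h (u w : TensorAlgebra k V) :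
      extend r (u ⊗ₜ w) = TensorAlgebra.lift k (stepLeft r) u (w ⊗ₜ 1) := rfl
  suffices H : ∀ a, TensorAlgebra.lift k (stepLeft r) u (1 ⊗ₜ a) = 1 ⊗ₜ (u * a) by
    rw [h, H, mul_one]
  induction u using TensorAlgebra.induction with
  | algebraMap s =>
    intro a
    rw [← Algebra.smul_def, TensorProduct.tmul_smul]
    simp [AlgHom.commutes, Module.algebraMap_end_apply]
  | ι y => intro a; simp [stepLeft_tmul, crossOne_one]
  | mul p q hp hq => intro a; simp [hp, hq, mul_assoc]
  | add p q hp hq => intro a; simp [hp, hq, add_mul, TensorProduct.tmul_add]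

lemma comul_one (c : V ⊗[k] V →ₗ[k] V ⊗[k] V) : comul c 1 = 1 ⊗ₜ 1 := by
  simp [comul]

lemma comul_ι_mul (c : V ⊗[k] V →ₗ[k] V ⊗[k] V) (x : V) (a : TensorAlgebra k V) :
    comul c (TensorAlgebra.ι k x * a) =
      twistedMul c ((TensorAlgebra.ι k x ⊗ₜ 1 + 1 ⊗ₜ TensorAlgebra.ι k x) ⊗ₜ comul c a) := by
  simp [comul, TensorProduct.add_tmul]

lemma comul_ι (c : V ⊗[k] V →ₗ[k] V ⊗[k] V) (x : V) :
    comul c (TensorAlgebra.ι k x) = TensorAlgebra.ι k x ⊗ₜ 1 + 1 ⊗ₜ TensorAlgebra.ι k x := by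
  have h := comul_ι_mul c x 1
  rw [mul_one] at h
  rw [h, comul_one]
  simp [twistedMul, TensorProduct.add_tmul, extend_one_left, extend_ι_one]

end Braiding

section Triangular

variable {k V ι : Type*} [Field k] [AddCommGroup V] [Module k V] [Fintype ι] [LinearOrder ι]

/-- `r` is left triangular with respect to the totally ordered basis `b`:
`r (x ⊗ y) = γ_{x,y} y ⊗ x + ∑_{z > y} z ⊗ v_{x,y,z}` for all basis vectors `x, y`. -/
def IsLeftTriangular (b : Module.Basis ι k V) (r : V ⊗[k] V →ₗ[k] V ⊗[k] V) : Prop :=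
  ∃ (γ : ι → ι → k) (w : ι → ι → ι → V), ∀ x y : ι,
    r (b x ⊗ₜ b y) = γ x y • (b y ⊗ₜ b x) + ∑ z ∈ Finset.univ.filter (fun z => y < z), b z ⊗ₜ w x y z

/-- The diagonal coefficient `γ_{x,y}` of `r`: the coefficient of `y ⊗ x` in `r (x ⊗ y)`. -/
def diagCoeff (b : Module.Basis ι k V) (r : V ⊗[k] V →ₗ[k] V ⊗[k] V) (x y : ι) : k :=
  (b.tensorProduct b).repr (r (b x ⊗ₜ b y)) (y, x)

/-- The coefficients `γ_{x,y}` in the definition of a left triangular endomorphism are unique. -/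
lemma diagCoeff_eq (b : Module.Basis ι k V) (r : V ⊗[k] V →ₗ[k] V ⊗[k] V)
    (γ : ι → ι → k) (w : ι → ι → ι → V)
    (h : ∀ x y : ι, r (b x ⊗ₜ b y) =
      γ x y • (b y ⊗ₜ b x) + ∑ z ∈ Finset.univ.filter (fun z => y < z), b z ⊗ₜ w x y z)
    (x y : ι) : diagCoeff b r x y = γ x y := by
  rw [diagCoeff, h, map_add, map_smul, map_sum, Finsupp.add_apply, Finsupp.finsetSum_apply,
    Finset.sum_eq_zero]
  · simp
  · intro z hz
    have hz' : y ≠ z := (Finset.mem_filter.mp hz).2.ne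
    simp [hz'.symm]

/-- The diagonal component `d` of `r`: `d (x ⊗ y) = γ_{x,y} y ⊗ x` for basis vectors `x, y`. -/
def diagComponent (b : Module.Basis ι k V) (r : V ⊗[k] V →ₗ[k] V ⊗[k] V) :
    V ⊗[k] V →ₗ[k] V ⊗[k] V :=
  (b.tensorProduct b).constr k fun p => diagCoeff b r p.1 p.2 • (b p.2 ⊗ₜ[k] b p.1)

/-- The coefficients `γ_{u,v}` for words `u, v`: the biadditive extension of `γ_{x,y}`,
that is, the product of all `γ_{x,y}`, `x` a letter of `u` and `y` a letter of `v`. -/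
def wordCoeff (b : Module.Basis ι k V) (r : V ⊗[k] V →ₗ[k] V ⊗[k] V) (u v : List ι) : k :=
  (u.map fun x => (v.map fun y => diagCoeff b r x y).prod).prod

/-- The element of `T(V)` given by a word in the letters of the basis. -/
def word (b : Module.Basis ι k V) (u : List ι) : TensorAlgebra k V :=
  (u.map fun x => TensorAlgebra.ι k (b x)).prod

/-- A Lyndon word: a nonempty word smaller than all its proper endings. The order `<` on `List ι`
is the lexicographical order, in which a proper beginning of a word is smaller than the word. -/
def IsLyndon (u : List ι) : Prop :=
  u ≠ [] ∧ ∀ v w : List ι, v ≠ [] → w ≠ [] → u = v ++ w → u < w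

/-- The (strict) standard order on words: `u` is smaller than `v` if `v` is shorter than `u`, or if
they have the same length and `u` is lexicographically smaller than `v`. -/
def StdLT (u v : List ι) : Prop :=
  v.length < u.length ∨ (u.length = v.length ∧ u < v)

/-- The span of all words that are larger than `u` in the standard order. -/
def spanGT (b : Module.Basis ι k V) (u : List ι) : Submodule k (TensorAlgebra k V) :=
  Submodule.span k (word b '' {w | StdLT u w})

/-- The set `S_I` of Lyndon words `u` that do not lie in `k⟨X⟩_{≻ u} + I`. -/
def hardWords (b : Module.Basis ι k V) (I : Ideal (TensorAlgebra k V)) : Set (List ι) :=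
  {u | IsLyndon u ∧ word b u ∉ spanGT b u ⊔ I.restrictScalars k}

/-- The word `u ^ t`. -/
def wordPow (u : List ι) (t : ℕ) : List ι := (List.replicate t u).flatten

/-- The height `h_I(u)`: the least positive `t` with `u ^ t ∈ k⟨X⟩_{≻ u ^ t} + I`, and `∞` if there
is none. -/
def height (b : Module.Basis ι k V) (I : Ideal (TensorAlgebra k V)) (u : List ι) : ℕ∞ :=
  sInf ((fun t : ℕ => (t : ℕ∞)) '' {t : ℕ | 0 < t ∧
    word b (wordPow u t) ∈ spanGT b (wordPow u t) ⊔ I.restrictScalars k})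

end Triangular

end BraidedPBW

end

/-!
The proof compares leading words. Let `≻` be the standard order, in which the leading word of an
element is its smallest one, and call a word normal if it is not the leading word of an element of
`I`. Subwords of normal words are normal, and `h = h_I(v)` is the least exponent for which `v ^ h`
is not normal. The main point is that all Gaussian binomial coefficients `(h choose i)_q`,
`0 < i < h`, `q = γ_{v,v}`, vanish (`qBinom_eq_zero_of_height`). The statement about `q` and `h`
then follows from the `q`-binomial theorem: `(1 + X)(1 + q X) ⋯ (1 + q ^ (h - 1) X)` has only its
two extreme coefficients, which forces `q` to be a root of unity, `h` to be a multiple `t s` of its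
order `t`, and the binomial coefficients `(s choose j)`, `0 < j < s`, to vanish in `k`.

Every Lyndon word `u` has a bracketing `P_u` with leading word `u` and
`Δ P_u = P_u ⊗ 1 + 1 ⊗ P_u + ∑ a ⊗ a'` with words `a` that dominate `u`, that is, differ from `u`
at some place of both words, and have the larger letter at the first such place
(`IsLyndon.exists_isBracket`). For `u = s t` with Lyndon words `s` and `t` the commutator
`P_s P_t - γ_{t,s}⁻¹ P_t P_s` does it; this is where the invertibility of `c` enters, through
`γ_{t,s} ≠ 0`. The nonincreasing products of the `P_u` have all words as leading words, so modulo
`I` and shorter words `P_v ^ h` is a combination of such products with normal leading words `w`,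
`w > v ^ h`.

To this relation one applies `Δ` and then a functional on the left tensor factor that vanishes on
`I` and has leading word `m ^ i`. If `m` is at most as large as all the Lyndon factors that occur,
then modulo shorter words the image of a product `x P_m ^ e`, where the factors of `x` are larger
than `m`, is a multiple of `x P_m ^ (e - i)`, with coefficient `(e choose i)_{q_m}`,
`q_m = γ_{m,m}`, up to nonzero factors, because left words only grow under the triangular braiding
and because the multiplications by `m ⊗ 1` and `1 ⊗ P_m` commute up to `q_m`
(`comulHom_mul_pow_sub_mem`). The images have distinct leading words, which are normal as
beginnings of normal words, so all the coefficients vanish (`qBinom_count_eq_zero`). If some factor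
smaller than `v` occurred, the smallest one, with `i` its multiplicity, would give the
contradiction `(i choose i)_{q_m} = 0`. So `m = v` is allowed, and the product `P_v ^ h` gives
`(h choose i)_q = 0`.

Computations in the braided tensor square of `T(V)` are made in the algebra of the operators on
`T(V) ⊗ T(V)` generated by the multiplications `E u` by `u ⊗ 1` and `F u` by `1 ⊗ u` from the left.
Its commutation rule (`IsTwisted`) is all that is needed.
-/

open scoped TensorProduct

noncomputable section

namespace BraidedPBW

/-! ### Words and their lexicographical order -/

section Powers

variable {ι : Type*}

lemma wordPow_zero (u : List ι) : wordPow u 0 = [] := by simp [wordPow]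

lemma wordPow_one (u : List ι) : wordPow u 1 = u := by simp [wordPow]

lemma wordPow_add (u : List ι) (m n : ℕ) : wordPow u (m + n) = wordPow u m ++ wordPow u n := by
  rw [wordPow, wordPow, wordPow, ← List.flatten_append, List.replicate_append_replicate]

lemma wordPow_succ (u : List ι) (n : ℕ) : wordPow u (n + 1) = wordPow u n ++ u := by
  rw [wordPow_add, wordPow_one]

lemma length_wordPow (u : List ι) (n : ℕ) : (wordPow u n).length = n * u.length := by
  simp [wordPow]

end Powers

section Words

variable {ι : Type*} [LinearOrder ι]

lemma append_lt_append_left_iff (p a b : List ι) : p ++ a < p ++ b ↔ a < b := by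
  induction p with
  | nil => simp
  | cons x p ih => simp [ih]

/-- `a` dominates `u` if, at the first place where the two words differ, `a` has the larger letter
(and there is such a place in both words). Equivalently, `a` is larger than `u` in the
lexicographical order, and stays so whatever is appended to both words. -/
def Dom (a u : List ι) : Prop := ∀ s t : List ι, u ++ s < a ++ t

lemma Dom.lt {a u : List ι} (h : Dom a u) : u < a := by simpa using h [] []

lemma Dom.trans {a b c : List ι} (h : Dom a b) (h' : Dom b c) : Dom a c := fun s t =>
  (h' s []).trans (by simpa using h [] t)

lemma Dom.append_left {a u : List ι} (h : Dom a u) (s : List ι) : Dom (a ++ s) u := fun s' t => by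
  simpa [List.append_assoc] using h s' (s ++ t)

lemma Dom.append_right {a u : List ι} (h : Dom a u) (s : List ι) : Dom a (u ++ s) := fun s' t => by
  simpa [List.append_assoc] using h (s ++ s') t

lemma Dom.append_append {a u : List ι} (h : Dom a u) (p : List ι) : Dom (p ++ a) (p ++ u) :=
  fun s t => by simpa [List.append_assoc, append_lt_append_left_iff] using h s t

lemma dom_or_prefix_of_lt {u w : List ι} (h : u < w) : Dom w u ∨ ∃ s, s ≠ [] ∧ w = u ++ s := by
  induction u generalizing w with
  | nil => exact Or.inr ⟨w, by rintro rfl; simp at h, rfl⟩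
  | cons x u ih =>
    cases w with
    | nil => simp at h
    | cons y w =>
      rcases List.cons_lt_cons_iff.mp h with h | ⟨rfl, h⟩
      · exact Or.inl fun s t => by simp [List.cons_lt_cons_iff, h]
      · rcases ih ((append_lt_append_left_iff [x] u w).mp h) with h | ⟨s, hs, rfl⟩
        · exact Or.inl (h.append_append [x])
        · exact Or.inr ⟨s, hs, rfl⟩

lemma dom_of_lt_of_length_le {u w : List ι} (h : u < w) (hl : w.length ≤ u.length) : Dom w u := by
  rcases dom_or_prefix_of_lt h with h | ⟨s, hs, rfl⟩
  · exact h
  · have := List.length_pos_iff.mpr hs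
    rw [List.length_append] at hl
    omega

lemma Dom.mono {a a' u : List ι} (h : Dom a u) (hle : a ≤ a') (hl : a'.length = a.length) :
    Dom a' u := by
  rcases hle.eq_or_lt with rfl | hlt
  · exact h
  · exact (dom_of_lt_of_length_le hlt hl.le).trans h

lemma append_lt_append_of_le_of_lt {a a' b b' : List ι} (ha : a ≤ a') (hb : b < b')
    (hl : a'.length = a.length) : a ++ b < a' ++ b' := by
  rcases ha.eq_or_lt with rfl | ha
  · exact (append_lt_append_left_iff _ _ _).mpr hb
  · exact dom_of_lt_of_length_le ha hl.le b b'

lemma append_le_append {a a' b b' : List ι} (ha : a ≤ a') (hb : b ≤ b')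
    (hl : a'.length = a.length) : a ++ b ≤ a' ++ b' := by
  rcases hb.eq_or_lt with rfl | hb
  · rcases ha.eq_or_lt with rfl | ha
    · exact le_rfl
    · exact (dom_of_lt_of_length_le ha hl.le b b).le
  · exact (append_lt_append_of_le_of_lt ha hb hl).le

/-! ### Lyndon words -/

lemma exists_min_suffix {u : List ι} (hu : u ≠ []) :
    ∃ p b, b ≠ [] ∧ u = p ++ b ∧ ∀ b', b' ≠ [] → b' <:+ u → b ≤ b' := by
  obtain ⟨b, hb, hmin⟩ := Finset.exists_min_image (u.tails.toFinset.filter (· ≠ [])) id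
    ⟨u, by simp [hu]⟩
  simp only [ne_eq, Finset.mem_filter, List.mem_toFinset, List.mem_tails, id, and_imp] at hb hmin
  obtain ⟨⟨p, rfl⟩, hb⟩ := hb
  exact ⟨p, b, hb, rfl, fun b' h h' => hmin b' h' h⟩

lemma isLyndon_of_min {u b : List ι} (hb : b ≠ []) (hbu : b <:+ u)
    (hmin : ∀ b', b' ≠ [] → b' <:+ u → b ≤ b') : IsLyndon b := by
  refine ⟨hb, fun v w hv hw hbv => lt_of_le_of_ne (hmin w hw ?_) ?_⟩
  · exact (List.IsSuffix.trans ⟨v, hbv.symm⟩ hbu)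
  · rintro rfl
    have := congrArg List.length hbv
    have := List.length_pos_iff.mpr hv
    rw [List.length_append] at *
    omega

lemma IsLyndon.dom_suffix {a b : List ι} (h : IsLyndon (a ++ b)) (ha : a ≠ []) (hb : b ≠ []) :
    Dom b (a ++ b) :=
  dom_of_lt_of_length_le (h.2 a b ha hb rfl) (by simp)

/-- A Lyndon word with at least two letters is a product of two Lyndon words: the second factor is
its smallest proper ending. -/
lemma IsLyndon.exists_factorization {u : List ι} (hu : IsLyndon u) (hl : 1 < u.length) :
    ∃ a b, IsLyndon a ∧ IsLyndon b ∧ u = a ++ b := by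
  obtain ⟨x, u', rfl⟩ := List.exists_cons_of_ne_nil hu.1
  have hu' : u' ≠ [] := by rintro rfl; simp at hl
  obtain ⟨p, b, hb, rfl, hmin⟩ := exists_min_suffix hu'
  refine ⟨x :: p, b, ⟨by simp, fun s t hs ht hst => ?_⟩, isLyndon_of_min hb ⟨p, rfl⟩ hmin, by simp⟩
  have hu2 : x :: (p ++ b) = s ++ (t ++ b) := by
    rw [← List.append_assoc, ← hst]; rfl
  have h1 : x :: (p ++ b) < t ++ b := hu.2 s (t ++ b) hs (by simp [ht]) hu2
  have hlen : (x :: p).length = s.length + t.length := by rw [hst]; simp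
  have hspos := List.length_pos_iff.mpr hs
  by_contra hcon
  rcases (not_lt.mp hcon).eq_or_lt with h | h
  · rw [h] at hlen; omega
  rcases dom_or_prefix_of_lt h with h | ⟨r, hr, hpr⟩
  · exact absurd h1 (not_lt.mpr (h b b).le)
  · have h2 : r ++ b < b := by
      have h3 : t ++ (r ++ b) < t ++ b := by
        rw [← List.append_assoc, ← hpr]; exact h1
      exact (append_lt_append_left_iff _ _ _).mp h3
    refine absurd h2 (not_lt.mpr (hmin _ (by simp [hb]) ?_))
    obtain ⟨y, t', rfl⟩ := List.exists_cons_of_ne_nil ht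
    simp only [List.cons_append, List.cons.injEq] at hpr
    exact ⟨t', by rw [hpr.2]; simp⟩

/-- Every word is a product of a nonincreasing sequence of Lyndon words: the last factor is the
smallest nonempty ending. -/
lemma exists_lyndon_factorization (w : List ι) :
    ∃ L : List (List ι), L.flatten = w ∧ (∀ l ∈ L, IsLyndon l) ∧ L.Pairwise (· ≥ ·) := by
  induction hn : w.length using Nat.strong_induction_on generalizing w with
  | _ n ih =>
    by_cases hw : w = []
    · exact ⟨[], by simp [hw], by simp, by simp⟩
    obtain ⟨p, b, hb, rfl, hmin⟩ := exists_min_suffix hw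
    have hbpos := List.length_pos_iff.mpr hb
    obtain ⟨L, hL, hLy, hs⟩ := ih p.length (by simp at hn; omega) p rfl
    have hbL := isLyndon_of_min hb ⟨p, rfl⟩ hmin
    refine ⟨L ++ [b], by simp [hL], ?_, ?_⟩
    · intro l hl
      rcases List.mem_append.mp hl with hl | hl
      · exact hLy l hl
      · rw [List.mem_singleton.mp hl]; exact hbL
    · -- only the last factor `l` of `p` has to be compared with `b`
      rcases L.eq_nil_or_concat' with rfl | ⟨L', l, rfl⟩
      · simp
      have hbl : b ≤ l := by
        by_contra hcon
        have hlt := not_le.mp hcon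
        have h1 : b ≤ l ++ b := hmin _ (by simp [hb]) ⟨L'.flatten, by simp [← hL]⟩
        rcases dom_or_prefix_of_lt hlt with h | ⟨r, hr, rfl⟩
        · exact absurd h1 (not_le.mpr (by simpa using h b []))
        · have h2 : r ≤ l ++ r := by
            by_contra h3
            exact absurd h1 (not_le.mpr ((append_lt_append_left_iff _ _ _).mpr (not_le.mp h3)))
          exact absurd h2 (not_le.mpr (hbL.2 l r (hLy l (by simp)).1 hr rfl))
      rw [List.pairwise_append]
      refine ⟨hs, by simp, fun x hx y hy => ?_⟩
      rw [List.mem_singleton.mp hy]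
      rcases List.mem_append.mp hx with hx | hx
      · exact hbl.trans ((List.pairwise_append.mp hs).2.2 x hx l (by simp))
      · rw [List.mem_singleton.mp hx]; exact hbl

lemma exists_eq_append_replicate {L : List (List ι)} {m : List ι} (hs : L.Pairwise (· ≥ ·))
    (hm : ∀ l ∈ L, m ≤ l) :
    ∃ L' e, L = L' ++ List.replicate e m ∧ ∀ l ∈ L', m < l := by
  induction L with
  | nil => exact ⟨[], 0, by simp, by simp⟩
  | cons l L ih =>
    obtain ⟨L', e, rfl, hL'⟩ := ih hs.of_cons fun l' hl' => hm l' (by simp [hl'])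
    rcases (hm l (by simp)).eq_or_lt with rfl | hlt
    · have : L' = [] := by
        refine List.eq_nil_iff_forall_not_mem.mpr fun l' hl' => ?_
        exact absurd (hL' l' hl') (not_lt.mpr (List.rel_of_pairwise_cons hs (by simp [hl'])))
      exact ⟨[], e + 1, by simp [this, List.replicate_succ], by simp⟩
    · exact ⟨l :: L', e, by simp, by simpa using ⟨hlt, hL'⟩⟩

/-- `a` dominates the infinite periodic word `m m m ⋯`. -/
def DomPow (m a : List ι) : Prop := ∃ n, Dom a (wordPow m n)

lemma DomPow.of_dom {m a : List ι} (h : Dom a m) : DomPow m a := ⟨1, by rwa [wordPow_one]⟩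

lemma DomPow.wordPow_append {m a : List ι} (h : DomPow m a) (j : ℕ) :
    DomPow m (wordPow m j ++ a) := by
  obtain ⟨n, hn⟩ := h
  exact ⟨j + n, by rw [wordPow_add]; exact hn.append_append _⟩

lemma DomPow.append {m a : List ι} (h : DomPow m a) (s : List ι) : DomPow m (a ++ s) :=
  h.imp fun _ hn => hn.append_left s

lemma DomPow.mono {m a a' : List ι} (h : DomPow m a) (hle : a ≤ a') (hl : a'.length = a.length) :
    DomPow m a' :=
  h.imp fun _ hn => hn.mono hle hl

lemma DomPow.trans {m a a' : List ι} (h : DomPow m a) (h' : Dom a' a) : DomPow m a' :=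
  h.imp fun _ hn => h'.trans hn

lemma DomPow.lt {m a : List ι} (h : DomPow m a) {k : ℕ} (hk : a.length = (wordPow m k).length) :
    wordPow m k < a := by
  obtain ⟨n, hn⟩ := h
  by_contra hcon
  have h1 : Dom (wordPow m k) (wordPow m n) := hn.mono (not_lt.mp hcon) hk.symm
  have h2 := h1 (wordPow m k) (wordPow m n)
  rw [← wordPow_add, ← wordPow_add, add_comm] at h2
  exact lt_irrefl _ h2

/-- A Lyndon word that is larger than the Lyndon word `m` dominates the infinite word `m m m ⋯`. -/
lemma IsLyndon.domPow {m l : List ι} (hm : m ≠ []) (hl : IsLyndon l) (hlt : m < l) :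
    DomPow m l := by
  have key : ∀ (n : ℕ) (j : ℕ) (s : List ι), s.length = n → l = wordPow m j ++ s → s ≠ [] →
      DomPow m l := by
    intro n
    induction n using Nat.strong_induction_on with
    | _ n ih =>
      intro j s hs hls hne
      have hms : m < s := by
        rcases Nat.eq_zero_or_pos j with rfl | hj
        · rw [wordPow_zero, List.nil_append] at hls; rwa [← hls]
        · refine hlt.trans (hl.2 _ s ?_ hne hls)
          rw [← List.length_pos_iff, length_wordPow]
          exact Nat.mul_pos hj (List.length_pos_iff.mpr hm)
      rcases dom_or_prefix_of_lt hms with h | ⟨r, hr, rfl⟩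
      · exact ⟨j + 1, by rw [wordPow_succ, hls]; exact h.append_append _⟩
      · refine ih r.length ?_ (j + 1) r rfl ?_ hr
        · have := List.length_pos_iff.mpr hm
          simp at hs; omega
        · rw [wordPow_succ, hls, List.append_assoc]
  exact key _ 0 l rfl (by rw [wordPow_zero, List.nil_append]) hl.1

end Words

/-! ### Gaussian binomial coefficients -/

section QBinomial

open Polynomial Finset

variable {k : Type*} [Field k]

/-- The Gaussian binomial coefficient `(n choose j)_q`. -/
def qBinom (q : k) : ℕ → ℕ → k
  | _, 0 => 1
  | 0, _ + 1 => 0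
  | n + 1, j + 1 => qBinom q n (j + 1) + q ^ (n - j) * qBinom q n j

lemma qBinom_zero_right (q : k) (n : ℕ) : qBinom q n 0 = 1 := by cases n <;> simp [qBinom]

lemma qBinom_succ_succ (q : k) (n j : ℕ) :
    qBinom q (n + 1) (j + 1) = qBinom q n (j + 1) + q ^ (n - j) * qBinom q n j := by simp [qBinom]

lemma qBinom_eq_zero_of_lt (q : k) {n j : ℕ} (h : n < j) : qBinom q n j = 0 := by
  induction n generalizing j with
  | zero => obtain ⟨j, rfl⟩ := Nat.exists_eq_succ_of_ne_zero h.ne'; simp [qBinom]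
  | succ n ih =>
    obtain ⟨j, rfl⟩ := Nat.exists_eq_succ_of_ne_zero (Nat.ne_of_gt (Nat.zero_lt_of_lt h))
    simp [qBinom_succ_succ, ih (show n < j + 1 by omega), ih (show n < j by omega)]

lemma qBinom_self (q : k) (n : ℕ) : qBinom q n n = 1 := by
  induction n with
  | zero => simp [qBinom]
  | succ n ih => simp [qBinom_succ_succ, qBinom_eq_zero_of_lt, ih]

lemma qBinom_one_right (q : k) (n : ℕ) : qBinom q n 1 = ∑ i ∈ range n, q ^ i := by
  induction n with
  | zero => simp [qBinom]
  | succ n ih => rw [qBinom_succ_succ, ih, sum_range_succ, qBinom_zero_right]; simp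

/-- The coefficients of `(1 + X) (1 + q X) ⋯ (1 + q ^ (n - 1) X)`: the `q`-binomial theorem. -/
lemma coeff_prod_one_add (q : k) (n j : ℕ) :
    (∏ i ∈ range n, (1 + C (q ^ i) * X)).coeff j = q ^ (j.choose 2) * qBinom q n j := by
  induction n generalizing j with
  | zero => cases j <;> simp [qBinom, coeff_one]
  | succ n ih =>
    rw [prod_range_succ, mul_add, mul_one, coeff_add, ih, ← mul_assoc, mul_comm _ (C _), mul_assoc,
      coeff_C_mul]
    cases j with
    | zero => simp [qBinom_zero_right]
    | succ j =>
      rw [coeff_mul_X, ih, qBinom_succ_succ, Nat.choose_succ_succ', Nat.choose_one_right]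
      rcases le_or_gt j n with h | h
      · obtain ⟨d, rfl⟩ := Nat.exists_eq_add_of_le h
        rw [Nat.add_sub_cancel_left]; ring
      · simp [qBinom_eq_zero_of_lt q h]

lemma prod_one_add_mul_X {q : k} {t : ℕ} (hq : IsPrimitiveRoot q t) (ht : 0 < t) :
    ∏ i ∈ range t, (1 + C (q ^ i) * X) = 1 - (-X) ^ t := by
  have h := congrArg (eval 1) (X_pow_sub_C_eq_prod (R := k[X])
    (hq.map_of_injective C_injective) ht (rfl : (-X : k[X]) ^ t = _))
  simp only [eval_sub, eval_pow, eval_X, eval_C, one_pow, eval_prod] at h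
  rw [h]
  exact prod_congr rfl fun i _ => by rw [map_pow]; ring

lemma prod_one_add_mul_X_mul {q : k} {t : ℕ} (hq : IsPrimitiveRoot q t)
    (ht : 0 < t) (s : ℕ) :
    ∏ i ∈ range (t * s), (1 + C (q ^ i) * X) = (1 - (-X) ^ t) ^ s := by
  induction s with
  | zero => simp
  | succ s ih =>
    rw [Nat.mul_succ, prod_range_add, ih, pow_succ, ← prod_one_add_mul_X hq ht]
    simp only [pow_add, pow_mul, hq.pow_eq_one, one_pow, one_mul]

/-- A case of the `q`-Lucas theorem: both sides of the `q`-binomial theorem are polynomials in the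
`t`-th power of the variable if `q` has order `t`. -/
lemma choose_eq_zero_of_qBinom_eq_zero {q : k} {t : ℕ} (hq : IsPrimitiveRoot q t) (ht : 0 < t)
    (s j : ℕ) (h : qBinom q (t * s) (t * j) = 0) : (s.choose j : k) = 0 := by
  have h1 := coeff_prod_one_add q (t * s) (t * j)
  have h2 : (1 - (-X : k[X]) ^ t) ^ s =
      expand k t (((1 + X) ^ s).comp (C (-(-1 : k) ^ t) * X)) := by
    simp only [pow_comp, add_comp, one_comp, X_comp, map_pow, map_add, map_mul, expand_X, expand_C,
      map_one]
    rw [neg_pow (X : k[X]) t]; simp [sub_eq_add_neg]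
  rw [prod_one_add_mul_X_mul hq ht, h2, mul_comm t j, coeff_expand_mul ht, comp_C_mul_X_coeff,
    coeff_one_add_X_pow, mul_comm j t, h, mul_zero] at h1
  exact (mul_eq_zero.mp h1).resolve_right (by simp)

/-- If all proper Gaussian binomial coefficients of `h` vanish, then `h` is a multiple of the order
of `q`, and all proper binomial coefficients of the quotient vanish. -/
lemma exists_mul_orderOf_of_qBinom_eq_zero {q : k} {h : ℕ} (hh : 1 < h)
    (hq : ∀ i, 0 < i → i < h → qBinom q h i = 0) :
    IsOfFinOrder q ∧ ∃ s, h = orderOf q * s ∧ 0 < s ∧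
      ∀ j, 0 < j → j < s → (s.choose j : k) = 0 := by
  have h1 : q ^ h = 1 := by
    have := hq 1 one_pos hh
    rw [qBinom_one_right] at this
    have h2 := geom_sum_mul q h
    rw [this, zero_mul] at h2
    exact (sub_eq_zero.mp h2.symm)
  have hfin : IsOfFinOrder q := isOfFinOrder_iff_pow_eq_one.mpr ⟨h, by omega, h1⟩
  obtain ⟨s, hs⟩ := orderOf_dvd_of_pow_eq_one h1
  have ht := hfin.orderOf_pos
  have hs0 : 0 < s := Nat.pos_of_ne_zero (by rintro rfl; omega)
  refine ⟨hfin, s, hs, hs0, fun j hj hjs => ?_⟩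
  refine choose_eq_zero_of_qBinom_eq_zero (IsPrimitiveRoot.orderOf q) ht s j ?_
  rw [← hs]
  exact hq _ (Nat.mul_pos ht hj) (by rw [hs]; exact Nat.mul_lt_mul_of_pos_left hjs ht)

lemma orderOf_eq_of_qBinom_eq_zero [CharZero k] {q : k} {h : ℕ} (hh : 1 < h)
    (hq : ∀ i, 0 < i → i < h → qBinom q h i = 0) : q ≠ 1 ∧ h = orderOf q := by
  obtain ⟨-, s, hs, hs0, hch⟩ := exists_mul_orderOf_of_qBinom_eq_zero hh hq
  have h1 : s = 1 := by
    by_contra hne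
    have := hch 1 one_pos (by omega)
    rw [Nat.choose_one_right, Nat.cast_eq_zero] at this
    omega
  subst h1
  rw [mul_one] at hs
  refine ⟨?_, hs⟩
  rintro rfl
  rw [orderOf_one] at hs
  omega

lemma exists_eq_orderOf_mul_pow_of_qBinom_eq_zero {p : ℕ} (hp : p.Prime) [CharP k p] {q : k} {h : ℕ}
    (hh : 1 < h) (hq : ∀ i, 0 < i → i < h → qBinom q h i = 0) : ∃ l, h = orderOf q * p ^ l := by
  obtain ⟨-, s, hs, hs0, hch⟩ := exists_mul_orderOf_of_qBinom_eq_zero hh hq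
  have : Fact p.Prime := ⟨hp⟩
  refine ⟨multiplicity p s, ?_⟩
  rw [← Choose.eq_pow_multiplicity_of_choose_modEq_zero_nat hs0, ← hs]
  intro i hi
  rw [mem_Icc] at hi
  rw [Nat.modEq_zero_iff_dvd, ← CharP.cast_eq_zero_iff k]
  exact hch i (by omega) (by omega)

end QBinomial

/-! ### Multiplication operators of the braided tensor square -/

section Operators

variable {k V : Type*} [Field k] [AddCommGroup V] [Module k V]

/-- The operator `a ⊗ b ↦ u a ⊗ b` on `T(V) ⊗ T(V)`: multiplication by `u ⊗ 1` from the left in the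
braided tensor square. -/
def opLeft (k V : Type*) [Field k] [AddCommGroup V] [Module k V] :
    TensorAlgebra k V →ₐ[k] Module.End k (TensorAlgebra k V ⊗[k] TensorAlgebra k V) :=
  (Module.End.rTensorAlgHom k (TensorAlgebra k V) (TensorAlgebra k V)).comp
    (Algebra.lmul k (TensorAlgebra k V))

/-- The operator `a ⊗ b ↦ r (u ⊗ a) · (1 ⊗ b)` on `T(V) ⊗ T(V)`: multiplication by `1 ⊗ u` from the
left in the braided tensor square. -/
def opRight (r : V ⊗[k] V →ₗ[k] V ⊗[k] V) :
    TensorAlgebra k V →ₐ[k] Module.End k (TensorAlgebra k V ⊗[k] TensorAlgebra k V) :=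
  TensorAlgebra.lift k (stepLeft r)

/-- The algebra homomorphism on `T(V)` that sends a vector `x` to `E x + F x`. If `E u` and `F u`
are the multiplications by `u ⊗ 1` and `1 ⊗ u` in the braided tensor square, the image of `u` is
the multiplication by `Δ u`. -/
def comulHom {A : Type*} [Semiring A] [Algebra k A] (E F : TensorAlgebra k V →ₐ[k] A) :
    TensorAlgebra k V →ₐ[k] A :=
  TensorAlgebra.lift k (E.toLinearMap ∘ₗ TensorAlgebra.ι k + F.toLinearMap ∘ₗ TensorAlgebra.ι k)

lemma comulHom_ι {A : Type*} [Semiring A] [Algebra k A] (E F : TensorAlgebra k V →ₐ[k] A) (x : V) :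
    comulHom E F (TensorAlgebra.ι k x) = E (TensorAlgebra.ι k x) + F (TensorAlgebra.ι k x) := by
  simp [comulHom]

lemma opLeft_tmul (u a b : TensorAlgebra k V) : opLeft k V u (a ⊗ₜ b) = (u * a) ⊗ₜ b := rfl

lemma opRight_ι (r : V ⊗[k] V →ₗ[k] V ⊗[k] V) (x : V) :
    opRight r (TensorAlgebra.ι k x) = stepLeft r x := by simp [opRight]

lemma opRight_one_tmul (r : V ⊗[k] V →ₗ[k] V ⊗[k] V) (u a : TensorAlgebra k V) :
    opRight r u (1 ⊗ₜ a) = 1 ⊗ₜ (u * a) := by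
  induction u using TensorAlgebra.induction generalizing a with
  | algebraMap s =>
    rw [← Algebra.smul_def, TensorProduct.tmul_smul]
    simp [AlgHom.commutes, Module.algebraMap_end_apply]
  | ι y => simp [opRight_ι, stepLeft_tmul, crossOne_one]
  | mul p q hp hq => simp [hp, hq, mul_assoc]
  | add p q hp hq => simp [hp, hq, add_mul, TensorProduct.tmul_add]

lemma opLeft_mul_opRight_apply_one (r : V ⊗[k] V →ₗ[k] V ⊗[k] V) (u v : TensorAlgebra k V) :
    (opLeft k V u * opRight r v) (1 ⊗ₜ 1) = u ⊗ₜ v := by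
  rw [Module.End.mul_apply, opRight_one_tmul, opLeft_tmul, mul_one, mul_one]

lemma opRight_tmul_one (r : V ⊗[k] V →ₗ[k] V ⊗[k] V) (u w : TensorAlgebra k V) :
    opRight r u (w ⊗ₜ 1) = extend r (u ⊗ₜ w) := rfl

lemma comul_eq_comulHom (r : V ⊗[k] V →ₗ[k] V ⊗[k] V) (u : TensorAlgebra k V) :
    comul r u = comulHom (opLeft k V) (opRight r) u (1 ⊗ₜ 1) := by
  rw [comul, comulHom, LinearMap.comp_apply]
  have h : (TensorProduct.curry (twistedMul r) :
          TensorAlgebra k V ⊗[k] TensorAlgebra k V →ₗ[k]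
            Module.End k (TensorAlgebra k V ⊗[k] TensorAlgebra k V)) ∘ₗ
        ((TensorProduct.mk k (TensorAlgebra k V) (TensorAlgebra k V)).flip 1 +
          TensorProduct.mk k (TensorAlgebra k V) (TensorAlgebra k V) 1) ∘ₗ
        TensorAlgebra.ι k = (opLeft k V).toLinearMap ∘ₗ TensorAlgebra.ι k +
          (opRight r).toLinearMap ∘ₗ TensorAlgebra.ι k := ?_
  · rw [h]; rfl
  refine LinearMap.ext fun x => TensorProduct.ext' fun a b => ?_
  simp only [LinearMap.coe_comp, Function.comp_apply,
    TensorProduct.curry_apply, LinearMap.add_apply,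
    LinearMap.flip_apply, TensorProduct.mk_apply, map_add,
    AlgHom.toLinearMap_apply, opLeft_tmul, opRight_ι, stepLeft_tmul]
  congr 1
  · simp [twistedMul, extend_one_left]
  · simp only [twistedMul, LinearMap.coe_comp, Function.comp_apply, LinearEquiv.coe_coe,
      TensorProduct.assoc_tmul, LinearMap.lTensor_tmul, TensorProduct.assoc_symm_tmul,
      LinearMap.rTensor_tmul, extend_ι_left]
    induction crossOne r x a with
    | zero => simp
    | tmul p q => simp
    | add p q hp hq => simp only [map_add, TensorProduct.add_tmul, TensorProduct.tmul_add, hp, hq]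

/-- The commutation rule `(1 ⊗ x) (y ⊗ 1) = r (x ⊗ y)` of the braided tensor square. -/
lemma stepLeft_mul_opLeft_ι (r : V ⊗[k] V →ₗ[k] V ⊗[k] V) (x y : V) :
    stepLeft r x * opLeft k V (TensorAlgebra.ι k y) =
      (LinearMap.mul' k _ ∘ₗ TensorProduct.map ((opLeft k V).toLinearMap ∘ₗ TensorAlgebra.ι k)
        (stepLeft r)) (r (x ⊗ₜ y)) := by
  have h1 : (crossOp r (TensorAlgebra.ι k y)).unop ((1 : TensorAlgebra k V) ⊗ₜ[k] x) =
      TensorProduct.map (TensorAlgebra.ι k) LinearMap.id (r (x ⊗ₜ y)) := by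
    simp only [crossOp, TensorAlgebra.lift_ι_apply, LinearMap.coe_comp, Function.comp_apply,
      LinearEquiv.coe_coe, MulOpposite.coe_opLinearEquiv, MulOpposite.unop_op, stepRight_tmul]
    congr 2
    ext; simp
  refine TensorProduct.ext' fun w a => ?_
  rw [Module.End.mul_apply, opLeft_tmul, stepLeft_tmul, crossOne_apply, map_mul,
    MulOpposite.unop_mul, Module.End.mul_apply, h1]
  induction r (x ⊗ₜ[k] y) with
  | zero => simp
  | add s t hs ht => simp only [map_add, hs, ht, LinearMap.add_apply]
  | tmul s t =>
    have h2 := crossOp_mulLeft r w (TensorAlgebra.ι k s) (1 ⊗ₜ t)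
    simp only [LinearMap.rTensor_tmul, LinearMap.mulLeft_apply, mul_one] at h2
    simp only [TensorProduct.map_tmul, LinearMap.id_apply, h2, ← crossOne_apply,
      LinearMap.coe_comp, Function.comp_apply, LinearMap.mul'_apply, Module.End.mul_apply,
      AlgHom.toLinearMap_apply, stepLeft_tmul]
    induction crossOne r t w with
    | zero => simp
    | tmul p q => simp [opLeft_tmul]
    | add p q hp hq => simp only [map_add, hp, hq]

end Operators

/-! ### Products of words in the operator algebra -/

section Words

variable {k V ι : Type*} [Field k] [AddCommGroup V] [Module k V]

lemma word_nil (b : Module.Basis ι k V) : word b [] = 1 := by simp [word]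

lemma word_cons (b : Module.Basis ι k V) (x : ι) (u : List ι) :
    word b (x :: u) = TensorAlgebra.ι k (b x) * word b u := by simp [word]

lemma word_append (b : Module.Basis ι k V) (u v : List ι) :
    word b (u ++ v) = word b u * word b v := by simp [word]

lemma wordCoeff_append_left (b : Module.Basis ι k V) (r : V ⊗[k] V →ₗ[k] V ⊗[k] V)
    (u u' v : List ι) : wordCoeff b r (u ++ u') v = wordCoeff b r u v * wordCoeff b r u' v := by
  simp [wordCoeff]

lemma wordCoeff_append_right (b : Module.Basis ι k V) (r : V ⊗[k] V →ₗ[k] V ⊗[k] V)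
    (u v v' : List ι) : wordCoeff b r u (v ++ v') = wordCoeff b r u v * wordCoeff b r u v' := by
  simp [wordCoeff, List.prod_map_mul]

lemma wordCoeff_nil_right (b : Module.Basis ι k V) (r : V ⊗[k] V →ₗ[k] V ⊗[k] V) (u : List ι) :
    wordCoeff b r u [] = 1 := by
  simp [wordCoeff]

lemma wordCoeff_nil_left (b : Module.Basis ι k V) (r : V ⊗[k] V →ₗ[k] V ⊗[k] V) (u : List ι) :
    wordCoeff b r [] u = 1 := by
  simp [wordCoeff]

lemma wordCoeff_singleton (b : Module.Basis ι k V) (r : V ⊗[k] V →ₗ[k] V ⊗[k] V) (x y : ι) :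
    wordCoeff b r [x] [y] = diagCoeff b r x y := by
  simp [wordCoeff]

lemma wordCoeff_perm_left (b : Module.Basis ι k V) (r : V ⊗[k] V →ₗ[k] V ⊗[k] V)
    {u u' : List ι} (h : u.Perm u') (v : List ι) : wordCoeff b r u v = wordCoeff b r u' v :=
  (h.map _).prod_eq

lemma wordCoeff_wordPow_left (b : Module.Basis ι k V) (r : V ⊗[k] V →ₗ[k] V ⊗[k] V)
    (u v : List ι) (n : ℕ) : wordCoeff b r (wordPow u n) v = wordCoeff b r u v ^ n := by
  induction n with
  | zero => simp [wordPow_zero, wordCoeff_nil_left]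
  | succ n ih => rw [wordPow_succ, wordCoeff_append_left, ih, pow_succ]

lemma wordCoeff_ne_zero (b : Module.Basis ι k V) (r : V ⊗[k] V →ₗ[k] V ⊗[k] V)
    (h : ∀ x y, diagCoeff b r x y ≠ 0) (u v : List ι) : wordCoeff b r u v ≠ 0 := by
  simp [wordCoeff, List.prod_eq_zero_iff, h]

variable {A : Type*} [Ring A] [Algebra k A]

/-- The span of the products `E u * F v`, for the pairs of words `u, v` with the property `Q`. -/
def opSpan (b : Module.Basis ι k V) (E F : TensorAlgebra k V →ₐ[k] A) (Q : List ι → List ι → Prop) :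
    Submodule k A :=
  Submodule.span k {f | ∃ u v, Q u v ∧ f = E (word b u) * F (word b v)}

variable {b : Module.Basis ι k V} {E F : TensorAlgebra k V →ₐ[k] A}
  {Q Q₁ Q₂ : List ι → List ι → Prop}

lemma mem_opSpan {u v : List ι} (h : Q u v) :
    E (word b u) * F (word b v) ∈ opSpan b E F Q :=
  Submodule.subset_span ⟨u, v, h, rfl⟩

lemma map_mem_of_mem_opSpan {M : Type*} [AddCommGroup M] [Module k M]
    (φ : A →ₗ[k] M) (S : Submodule k M)
    (h : ∀ u v, Q u v → φ (E (word b u) * F (word b v)) ∈ S)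
    {f : A} (hf : f ∈ opSpan b E F Q) :
    φ f ∈ S := by
  have : opSpan b E F Q ≤ S.comap φ := by
    rw [opSpan, Submodule.span_le]
    rintro _ ⟨u, v, huv, rfl⟩
    exact h u v huv
  exact this hf

lemma opSpan_mono (h : ∀ u v, Q₁ u v → Q₂ u v) : opSpan b E F Q₁ ≤ opSpan b E F Q₂ :=
  Submodule.span_mono fun _ ⟨u, v, huv, hf⟩ => ⟨u, v, h u v huv, hf⟩

lemma mul_mul_mem_of_mem_opSpan
    {x y f : A}
    {S : Submodule k A}
    (h : ∀ u v, Q u v → x * (E (word b u) * F (word b v)) * y ∈ S)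
    (hf : f ∈ opSpan b E F Q) : x * f * y ∈ S := by
  induction hf using Submodule.span_induction with
  | mem f hf => obtain ⟨u, v, huv, rfl⟩ := hf; exact h u v huv
  | zero => rw [mul_zero, zero_mul]; exact zero_mem _
  | add f g _ _ hf hg => rw [mul_add, add_mul]; exact add_mem hf hg
  | smul s f _ hf => rw [mul_smul_comm, smul_mul_assoc]; exact Submodule.smul_mem _ _ hf

lemma left_mul_mem_opSpan (u : List ι)
    (h : ∀ u' v, Q₁ u' v → Q₂ (u ++ u') v)
    {f : A} (hf : f ∈ opSpan b E F Q₁) :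
    E (word b u) * f ∈ opSpan b E F Q₂ := by
  rw [← mul_one (E (word b u) * f)]
  refine mul_mul_mem_of_mem_opSpan (fun u' v huv => ?_) hf
  rw [mul_one, ← mul_assoc, ← map_mul, ← word_append]
  exact mem_opSpan (h u' v huv)

lemma mul_right_mem_opSpan (v : List ι)
    (h : ∀ u v', Q₁ u v' → Q₂ u (v' ++ v))
    {f : A} (hf : f ∈ opSpan b E F Q₁) :
    f * F (word b v) ∈ opSpan b E F Q₂ := by
  rw [← one_mul (f * F (word b v)), ← mul_assoc]
  refine mul_mul_mem_of_mem_opSpan (fun u v' huv => ?_) hf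
  rw [one_mul, mul_assoc, ← map_mul, ← word_append]
  exact mem_opSpan (h u v' huv)

end Words

/-! ### Commutation rules -/

section Commutation

variable {k V ι : Type*} [Field k] [AddCommGroup V] [Module k V] [Fintype ι] [LinearOrder ι]
  {A : Type*} [Ring A] [Algebra k A] {b : Module.Basis ι k V} {r : V ⊗[k] V →ₗ[k] V ⊗[k] V}
  {E F : TensorAlgebra k V →ₐ[k] A}

/-- The commutation rule of the multiplications `E u` by `u ⊗ 1` and `F u` by `1 ⊗ u` in the
braided tensor square of `T(V)`, for a left triangular braiding `r`. It is stated for an arbitrary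
pair of algebra homomorphisms `E`, `F` into the same algebra. -/
def IsTwisted (b : Module.Basis ι k V) (r : V ⊗[k] V →ₗ[k] V ⊗[k] V)
    (E F : TensorAlgebra k V →ₐ[k] A) : Prop :=
  ∃ w : ι → ι → ι → V, ∀ x y, F (TensorAlgebra.ι k (b x)) * E (TensorAlgebra.ι k (b y)) =
    diagCoeff b r x y • (E (TensorAlgebra.ι k (b y)) * F (TensorAlgebra.ι k (b x))) +
    ∑ z ∈ Finset.univ.filter (fun z => y < z),
      E (TensorAlgebra.ι k (b z)) * F (TensorAlgebra.ι k (w x y z))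

/-- Moving a word across a letter: the leading term is given by the diagonal component, and the
other terms have a larger left word. -/
lemma right_letter_mul_left_word (hEF : IsTwisted b r E F) (x : ι) (u : List ι) :
    F (word b [x]) * E (word b u) -
      wordCoeff b r [x] u • (E (word b u) * F (word b [x])) ∈
      opSpan b E F fun u' v' => u'.length = u.length ∧ u < u' ∧ v'.length = 1 := by
  obtain ⟨w, hw⟩ := hEF
  have hx (x : ι) : F (word b [x]) = F (TensorAlgebra.ι k (b x)) := by
    rw [word_cons, word_nil, mul_one]
  induction u generalizing x with
  | nil =>
    rw [word_nil, map_one, mul_one, one_mul, wordCoeff_nil_right, one_smul, sub_self]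
    exact zero_mem _
  | cons y u ih =>
    have hcoeff : wordCoeff b r [x] (y :: u) = diagCoeff b r x y * wordCoeff b r [x] u := by
      rw [← wordCoeff_singleton, ← wordCoeff_append_right]; rfl
    have hy (z : ι) : E (TensorAlgebra.ι k (b z)) = E (word b [z]) := by
      rw [word_cons, word_nil, mul_one]
    have hweak (x : ι) : F (word b [x]) * E (word b u) ∈
        opSpan b E F fun u' v' => u'.length = u.length ∧ v'.length = 1 := by
      have h1 := opSpan_mono (Q₂ := fun u' v' => u'.length = u.length ∧ v'.length = 1)
        (fun u' v' h => ⟨h.1, h.2.2⟩) (ih x)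
      rw [← sub_add_cancel (F (word b [x]) * E (word b u))]
      exact add_mem h1 (Submodule.smul_mem _ _ (mem_opSpan ⟨rfl, rfl⟩))
    have hweak' (z : V) : F (TensorAlgebra.ι k z) * E (word b u) ∈
        opSpan b E F fun u' v' => u'.length = u.length ∧ v'.length = 1 := by
      rw [← b.sum_repr z, map_sum, map_sum, Finset.sum_mul]
      refine sum_mem fun i _ => ?_
      rw [map_smul, map_smul, smul_mul_assoc, ← hx]
      exact Submodule.smul_mem _ _ (hweak i)
    have key : F (word b [x]) * E (word b (y :: u)) -
        wordCoeff b r [x] (y :: u) • (E (word b (y :: u)) * F (word b [x])) =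
        diagCoeff b r x y • (E (word b [y]) * (F (word b [x]) *
          E (word b u) -
          wordCoeff b r [x] u • (E (word b u) * F (word b [x])))) +
        ∑ z ∈ Finset.univ.filter (fun z => y < z), E (word b [z]) *
          (F (TensorAlgebra.ι k (w x y z)) * E (word b u)) := by
      rw [hx, word_cons b y, map_mul, ← mul_assoc, hw, hcoeff, add_mul, Finset.sum_mul]
      simp only [hy, mul_sub, smul_mul_assoc, mul_smul_comm, smul_sub, mul_assoc, smul_smul]
      abel
    rw [key]
    refine add_mem (Submodule.smul_mem _ _ (left_mul_mem_opSpan _ ?_ (ih x)))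
      (sum_mem fun z hz => left_mul_mem_opSpan _ ?_ (hweak' _))
    · rintro u' v' ⟨h1, h2, h3⟩
      exact ⟨by simp [h1], (append_lt_append_left_iff [y] u u').mpr h2, h3⟩
    · rintro u' v' ⟨h1, h2⟩
      exact ⟨by simp [h1], List.cons_lt_cons_iff.mpr (Or.inl (Finset.mem_filter.mp hz).2), h2⟩

lemma right_word_mul_left_word (hEF : IsTwisted b r E F) (v u : List ι) :
    F (word b v) * E (word b u) -
      wordCoeff b r v u • (E (word b u) * F (word b v)) ∈
      opSpan b E F fun u' v' => u'.length = u.length ∧ u < u' ∧ v'.length = v.length := by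
  induction v with
  | nil =>
    rw [word_nil, map_one, mul_one, one_mul, wordCoeff_nil_left, one_smul, sub_self]
    exact zero_mem _
  | cons x v ih =>
    have hcoeff : wordCoeff b r (x :: v) u = wordCoeff b r [x] u * wordCoeff b r v u := by
      rw [← wordCoeff_append_left]; rfl
    have hweak (x : ι) (u : List ι) : F (word b [x]) * E (word b u) ∈
        opSpan b E F fun u' v' => u'.length = u.length ∧ u ≤ u' ∧ v'.length = 1 := by
      have h1 := opSpan_mono (Q₂ := fun u' v' => u'.length = u.length ∧ u ≤ u' ∧ v'.length = 1)
        (fun u' v' h => ⟨h.1, h.2.1.le, h.2.2⟩) (right_letter_mul_left_word hEF x u)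
      rw [← sub_add_cancel (F (word b [x]) * E (word b u))]
      exact add_mem h1 (Submodule.smul_mem _ _ (mem_opSpan ⟨rfl, le_rfl, rfl⟩))
    have hv : word b (x :: v) = word b [x] * word b v := by rw [← word_append]; rfl
    have key : F (word b (x :: v)) * E (word b u) -
        wordCoeff b r (x :: v) u • (E (word b u) * F (word b (x :: v))) =
        F (word b [x]) * (F (word b v) * E (word b u) -
          wordCoeff b r v u • (E (word b u) * F (word b v))) +
        wordCoeff b r v u • ((F (word b [x]) * E (word b u) -
          wordCoeff b r [x] u • (E (word b u) * F (word b [x]))) *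
          F (word b v)) := by
      rw [hv, map_mul, hcoeff]
      simp only [mul_sub, sub_mul, smul_mul_assoc, mul_smul_comm, smul_sub, mul_assoc, smul_smul]
      rw [mul_comm (wordCoeff b r [x] u)]
      abel
    rw [key]
    refine add_mem ?_ (Submodule.smul_mem _ _
      (mul_right_mem_opSpan _ ?_ (right_letter_mul_left_word hEF x u)))
    · rw [← mul_one (F (word b [x]) * _)]
      refine mul_mul_mem_of_mem_opSpan (fun u' v' h => ?_) ih
      rw [mul_one, ← mul_assoc]
      refine mul_right_mem_opSpan _ ?_ (hweak x u')
      rintro u'' v'' ⟨h1, h2, h3⟩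
      exact ⟨h1.trans h.1, h.2.1.trans_le h2, by simp [h3, h.2.2, add_comm]⟩
    · rintro u' v' ⟨h1, h2, h3⟩
      exact ⟨h1, h2, by simp [h3, add_comm]⟩

lemma right_word_mul_left_word_mem (hEF : IsTwisted b r E F) (v u : List ι) :
    F (word b v) * E (word b u) ∈
      opSpan b E F fun u' v' => u'.length = u.length ∧ u ≤ u' ∧ v'.length = v.length := by
  rw [← sub_add_cancel (F (word b v) * E (word b u))]
  exact add_mem (opSpan_mono (fun u' v' h => ⟨h.1, h.2.1.le, h.2.2⟩)
    (right_word_mul_left_word hEF v u)) (Submodule.smul_mem _ _ (mem_opSpan ⟨rfl, le_rfl, rfl⟩))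

/-- Products in the braided tensor square: the left words can only grow. -/
lemma mul_mem_opSpan (hEF : IsTwisted b r E F) {Q₁ Q₂ Q₃ : List ι → List ι → Prop}
    (h : ∀ u₁ v₁ u₂ v₂, Q₁ u₁ v₁ → Q₂ u₂ v₂ → ∀ u v, u.length = u₂.length → u₂ ≤ u →
      v.length = v₁.length → Q₃ (u₁ ++ u) (v ++ v₂))
    {f g : A}
    (hf : f ∈ opSpan b E F Q₁) (hg : g ∈ opSpan b E F Q₂) : f * g ∈ opSpan b E F Q₃ := by
  rw [← one_mul f]
  refine mul_mul_mem_of_mem_opSpan (fun u₁ v₁ h₁ => ?_) hf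
  rw [one_mul, ← mul_one (_ * g)]
  refine mul_mul_mem_of_mem_opSpan (fun u₂ v₂ h₂ => ?_) hg
  rw [mul_one, mul_assoc, ← mul_assoc (F _)]
  refine left_mul_mem_opSpan (Q₁ := fun u v => Q₃ (u₁ ++ u) v) _ (fun _ _ h => h) ?_
  refine mul_right_mem_opSpan _ ?_ (right_word_mul_left_word_mem hEF v₁ u₂)
  rintro u v ⟨h3, h4, h5⟩
  exact h u₁ v₁ u₂ v₂ h₁ h₂ u v h3 h4 h5

/-- The ring structure on the operators on `T(V) ⊗ T(V)` that extends their semiring structure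
reducibly, so that facts about an arbitrary algebra apply to them. -/
abbrev opRing (k V : Type*) [Field k] [AddCommGroup V] [Module k V] :
    Ring (Module.End k (TensorAlgebra k V ⊗[k] TensorAlgebra k V)) :=
  Algebra.semiringToRing k

attribute [local instance] opRing

lemma IsLeftTriangular.isTwisted (hr : IsLeftTriangular b r) :
    IsTwisted b r (opLeft k V) (opRight r) := by
  obtain ⟨γ, w, h⟩ := hr
  refine ⟨w, fun x y => ?_⟩
  rw [opRight_ι, stepLeft_mul_opLeft_ι, diagCoeff_eq b r γ w h, h]
  simp [opRight_ι]

end Commutation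

/-! ### Spans of words -/

section WordSpan

variable {k V ι : Type*} [Field k] [AddCommGroup V] [Module k V]

/-- The span of the words with the property `Q`. -/
def wordSpan (b : Module.Basis ι k V) (Q : List ι → Prop) : Submodule k (TensorAlgebra k V) :=
  Submodule.span k (word b '' {w | Q w})

variable {b : Module.Basis ι k V} {Q Q₁ Q₂ : List ι → Prop}

lemma word_mem_wordSpan {w : List ι} (h : Q w) : word b w ∈ wordSpan b Q :=
  Submodule.subset_span ⟨w, h, rfl⟩

lemma wordSpan_mono (h : ∀ w, Q₁ w → Q₂ w) : wordSpan b Q₁ ≤ wordSpan b Q₂ :=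
  Submodule.span_mono (Set.image_mono h)

lemma wordSpan_le {S : Submodule k (TensorAlgebra k V)} (h : ∀ w, Q w → word b w ∈ S) :
    wordSpan b Q ≤ S := by
  rw [wordSpan, Submodule.span_le]
  rintro _ ⟨w, hw, rfl⟩
  exact h w hw

lemma mul_mem_wordSpan (h : ∀ u v, Q₁ u → Q₂ v → Q (u ++ v)) {x y : TensorAlgebra k V}
    (hx : x ∈ wordSpan b Q₁) (hy : y ∈ wordSpan b Q₂) : x * y ∈ wordSpan b Q := by
  have h1 := Submodule.mul_mem_mul hx hy
  rw [wordSpan, wordSpan, Submodule.span_mul_span] at h1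
  refine Submodule.span_mono ?_ h1
  rintro _ ⟨_, ⟨u, hu, rfl⟩, _, ⟨v, hv, rfl⟩, rfl⟩
  exact ⟨u ++ v, h u v hu hv, word_append b u v⟩

lemma map_mem_of_mem_wordSpan {M : Type*} [AddCommMonoid M] [Module k M]
    (φ : TensorAlgebra k V →ₗ[k] M) (S : Submodule k M) (h : ∀ w, Q w → φ (word b w) ∈ S)
    {x : TensorAlgebra k V} (hx : x ∈ wordSpan b Q) : φ x ∈ S := by
  have : wordSpan b Q ≤ S.comap φ := wordSpan_le h
  exact this hx

variable {A : Type*} [Ring A] [Algebra k A] {E F : TensorAlgebra k V →ₐ[k] A}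

lemma map_left_mem_opSpan {Q : List ι → Prop} {Q' : List ι → List ι → Prop}
    (h : ∀ w, Q w → Q' w []) {z : TensorAlgebra k V} (hz : z ∈ wordSpan b Q) :
    E z ∈ opSpan b E F Q' :=
  map_mem_of_mem_wordSpan E.toLinearMap _ (fun w hw => by
    have := mem_opSpan (b := b) (E := E) (F := F) (h w hw)
    rwa [word_nil, map_one, mul_one] at this) hz

lemma map_right_mem_opSpan {Q : List ι → Prop} {Q' : List ι → List ι → Prop}
    (h : ∀ w, Q w → Q' [] w) {z : TensorAlgebra k V} (hz : z ∈ wordSpan b Q) :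
    F z ∈ opSpan b E F Q' :=
  map_mem_of_mem_wordSpan F.toLinearMap _ (fun w hw => by
    have := mem_opSpan (b := b) (E := E) (F := F) (h w hw)
    rwa [word_nil, map_one, one_mul] at this) hz

end WordSpan

/-! ### Bracketings of Lyndon words -/

section Bracket

variable {k V ι : Type*} [Field k] [AddCommGroup V] [Module k V] [LinearOrder ι]
  {A : Type*} [Ring A] [Algebra k A] {b : Module.Basis ι k V} {E F : TensorAlgebra k V →ₐ[k] A}

/-- `P` is a bracketing of the word `u`: it has leading word `u`, is a combination of
rearrangements of `u`, and is primitive up to terms whose left words dominate `u`. -/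
structure IsBracket (b : Module.Basis ι k V) (E F : TensorAlgebra k V →ₐ[k] A) (u : List ι)
    (P : TensorAlgebra k V) : Prop where
  sub_word_mem : P - word b u ∈ wordSpan b fun w => w.Perm u ∧ u < w
  comul_sub_mem : comulHom E F P - E P - F P ∈
    opSpan b E F fun u' v' => Dom u' u ∧ u'.length + v'.length = u.length

lemma IsBracket.mem {u : List ι} {P : TensorAlgebra k V} (h : IsBracket b E F u P) :
    P ∈ wordSpan b fun w => w.Perm u ∧ u ≤ w := by
  rw [← sub_add_cancel P (word b u)]
  exact add_mem (wordSpan_mono (fun w hw => ⟨hw.1, hw.2.le⟩) h.sub_word_mem)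
    (word_mem_wordSpan ⟨List.Perm.refl _, le_rfl⟩)

lemma isBracket_singleton (x : ι) : IsBracket b E F [x] (word b [x]) := by
  have hx : word b [x] = TensorAlgebra.ι k (b x) := by simp [word]
  refine ⟨by rw [sub_self]; exact zero_mem _, ?_⟩
  rw [hx, comulHom_ι, add_sub_cancel_left, sub_self]
  exact zero_mem _

variable [Fintype ι] {r : V ⊗[k] V →ₗ[k] V ⊗[k] V}

/-- Moving an element across another one, up to terms with larger left words. The weight
`wordCoeff b r w u` only depends on the letters of `w`, so that `y` may be any combination of
rearrangements of `w`. -/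
lemma map_mul_map_sub_mem_opSpan (hEF : IsTwisted b r E F) {w u : List ι}
    {y z : TensorAlgebra k V} (hy : y ∈ wordSpan b (·.Perm w))
    (hz : z ∈ wordSpan b fun u' => u'.length = u.length ∧ u ≤ u') :
    F y * E z - wordCoeff b r w u • (E z * F y) ∈
      opSpan b E F fun u' v' => u'.length = u.length ∧ u < u' ∧ v'.length = w.length := by
  refine map_mem_of_mem_wordSpan (LinearMap.mulRight k (E z) ∘ₗ F.toLinearMap -
    wordCoeff b r w u • (LinearMap.mulLeft k (E z) ∘ₗ F.toLinearMap)) _ (fun w' hw' => ?_) hy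
  refine map_mem_of_mem_wordSpan (LinearMap.mulLeft k (F (word b w')) ∘ₗ E.toLinearMap -
    wordCoeff b r w u • (LinearMap.mulRight k (F (word b w')) ∘ₗ E.toLinearMap)) _
      (fun u' hu' => ?_) hz
  simp only [LinearMap.sub_apply, LinearMap.smul_apply, LinearMap.comp_apply,
    LinearMap.mulLeft_apply, LinearMap.mulRight_apply, AlgHom.toLinearMap_apply]
  rcases hu'.2.eq_or_lt with rfl | hlt
  · rw [← wordCoeff_perm_left b r hw', ← hw'.length_eq]
    exact right_word_mul_left_word hEF w' u
  · refine sub_mem (opSpan_mono ?_ (right_word_mul_left_word_mem hEF w' u'))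
      (Submodule.smul_mem _ _ (mem_opSpan ⟨hu'.1, hlt, hw'.length_eq⟩))
    rintro s t ⟨h1, h2, h3⟩
    exact ⟨h1.trans hu'.1, hlt.trans_le h2, h3.trans hw'.length_eq⟩

/-- The comultiplication respects the total degree. -/
lemma comulHom_word_mem_opSpan (hEF : IsTwisted b r E F) (w : List ι) :
    comulHom E F (word b w) ∈ opSpan b E F fun u v => u.length + v.length = w.length := by
  induction w with
  | nil =>
    have := mem_opSpan (b := b) (E := E) (F := F)
      (Q := fun u v => u.length + v.length = ([] : List ι).length) (u := []) (v := []) rfl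
    simpa [word_nil] using this
  | cons x w ih =>
    have hx : word b [x] = TensorAlgebra.ι k (b x) := by simp [word]
    rw [word_cons, map_mul, comulHom_ι, ← hx]
    refine mul_mem_opSpan hEF (Q₁ := fun u v => u.length + v.length = 1) ?_
      (add_mem (map_left_mem_opSpan (Q := (· = [x])) (by simp) (word_mem_wordSpan rfl))
        (map_right_mem_opSpan (Q := (· = [x])) (by simp) (word_mem_wordSpan rfl))) ih
    intro u₁ v₁ u₂ v₂ h₁ h₂ u v h3 _ h5
    simp only [List.length_append, List.length_cons] at *
    omega

lemma comulHom_mem_opSpan (hEF : IsTwisted b r E F) {n : ℕ} {z : TensorAlgebra k V}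
    (hz : z ∈ wordSpan b fun w => w.length = n) :
    comulHom E F z ∈ opSpan b E F fun u v => u.length + v.length = n :=
  map_mem_of_mem_wordSpan (comulHom E F).toLinearMap _
    (fun w hw => hw ▸ comulHom_word_mem_opSpan hEF w) hz

/-- The braided commutator with respect to the inverse of the diagonal component. The coefficient
makes the term `u ⊗ v` of the comultiplication of the first product cancel against the leading term
of the product of `1 ⊗ v` and `u ⊗ 1`. -/
lemma IsBracket.commutator (hEF : IsTwisted b r E F) (hγ : ∀ x y, diagCoeff b r x y ≠ 0)
    {u v : List ι} (huv : Dom v (u ++ v)) {P R : TensorAlgebra k V}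
    (hP : IsBracket b E F u P) (hR : IsBracket b E F v R) :
    IsBracket b E F (u ++ v) (P * R - (wordCoeff b r v u)⁻¹ • (R * P)) := by
  have hγ' : wordCoeff b r v u ≠ 0 := wordCoeff_ne_zero b r hγ v u
  constructor
  · have h1 : P * R - (wordCoeff b r v u)⁻¹ • (R * P) - word b (u ++ v) =
        (P - word b u) * R + word b u * (R - word b v) - (wordCoeff b r v u)⁻¹ • (R * P) := by
      rw [word_append]; noncomm_ring
    rw [h1]
    refine sub_mem (add_mem (mul_mem_wordSpan ?_ hP.sub_word_mem hR.mem)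
      (mul_mem_wordSpan (Q₁ := (· = u)) ?_ (word_mem_wordSpan rfl) hR.sub_word_mem))
      (Submodule.smul_mem _ _ (mul_mem_wordSpan ?_ hR.mem hP.mem))
    · rintro s t ⟨h1, h2⟩ ⟨h3, -⟩
      exact ⟨h1.append h3, dom_of_lt_of_length_le h2 h1.length_eq.le v t⟩
    · rintro s t rfl ⟨h3, h4⟩
      exact ⟨h3.append_left _, (append_lt_append_left_iff _ _ _).mpr h4⟩
    · rintro s t ⟨h1, h2⟩ ⟨h3, -⟩
      exact ⟨(h1.append h3).trans List.perm_append_comm,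
        ((huv.mono h2 h1.length_eq).append_left t).lt⟩
  · obtain ⟨X, hX⟩ : ∃ X, X = comulHom E F P - E P - F P := ⟨_, rfl⟩
    obtain ⟨Y, hY⟩ : ∃ Y, Y = comulHom E F R - E R - F R := ⟨_, rfl⟩
    have hX' := hP.comul_sub_mem
    have hY' := hR.comul_sub_mem
    rw [← hX] at hX'
    rw [← hY] at hY'
    have hcP : comulHom E F P = E P + F P + X := by rw [hX]; abel
    have hcR : comulHom E F R = E R + F R + Y := by rw [hY]; abel
    have key : comulHom E F (P * R - (wordCoeff b r v u)⁻¹ • (R * P)) -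
        E (P * R - (wordCoeff b r v u)⁻¹ • (R * P)) - F (P * R - (wordCoeff b r v u)⁻¹ • (R * P)) =
        E P * Y + F P * E R + F P * Y + X * comulHom E F R -
        (wordCoeff b r v u)⁻¹ • (E R * F P + E R * X + F R * X + Y * comulHom E F P) -
        (wordCoeff b r v u)⁻¹ • (F R * E P - wordCoeff b r v u • (E P * F R)) := by
      simp only [map_sub, map_smul, map_mul, smul_sub, smul_smul, inv_mul_cancel₀ hγ', one_smul,
        hcP, hcR, smul_add, add_mul, mul_add]
      abel
    -- the left words of all the terms dominate `u ++ v`: they start with a word that dominates `u`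
    -- or `v`, with a word that is at least `v`, or with `u` followed by a word that dominates `v`
    rw [key]
    have hEP : E P ∈ opSpan b E F fun u' v' => u'.length = u.length ∧ u ≤ u' ∧ v'.length = 0 :=
      map_left_mem_opSpan (fun w hw => ⟨hw.1.length_eq, hw.2, rfl⟩) hP.mem
    have hER : E R ∈ opSpan b E F fun u' v' => u'.length = v.length ∧ v ≤ u' ∧ v'.length = 0 :=
      map_left_mem_opSpan (fun w hw => ⟨hw.1.length_eq, hw.2, rfl⟩) hR.mem
    have hFP : F P ∈ opSpan b E F fun u' v' => u' = [] ∧ v'.length = u.length :=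
      map_right_mem_opSpan (fun w hw => ⟨rfl, hw.1.length_eq⟩) hP.mem
    have hFR : F R ∈ opSpan b E F fun u' v' => u' = [] ∧ v'.length = v.length :=
      map_right_mem_opSpan (fun w hw => ⟨rfl, hw.1.length_eq⟩) hR.mem
    have hcP' := comulHom_mem_opSpan hEF (wordSpan_mono (fun w hw => hw.1.length_eq) hP.mem)
    have hcR' := comulHom_mem_opSpan hEF (wordSpan_mono (fun w hw => hw.1.length_eq) hR.mem)
    refine sub_mem (sub_mem (add_mem (add_mem (add_mem ?_ ?_) ?_) ?_)
      (Submodule.smul_mem _ _ (add_mem (add_mem (add_mem ?_ ?_) ?_) ?_)))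
      (Submodule.smul_mem _ _ (opSpan_mono ?_ (map_mul_map_sub_mem_opSpan hEF
        (wordSpan_mono (fun w hw => hw.1) hR.mem)
        (wordSpan_mono (fun w hw => ⟨hw.1.length_eq, hw.2⟩) hP.mem))))
    · refine mul_mem_opSpan hEF (fun u₁ v₁ u₂ v₂ h₁ h₂ s t hs hs' ht => ⟨?_, ?_⟩) hEP hY'
      · have h3 := h₂.1.mono hs' hs
        rcases h₁.2.1.eq_or_lt with rfl | h4
        · exact h3.append_append _
        · exact ((dom_of_lt_of_length_le h4 h₁.1.le).append_left _).append_right _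
      · simp only [List.length_append]; omega
    · refine mul_mem_opSpan hEF (fun u₁ v₁ u₂ v₂ h₁ h₂ s t hs hs' ht => ⟨?_, ?_⟩) hFP hER
      · rw [h₁.1, List.nil_append]
        exact (huv.mono h₂.2.1 h₂.1).mono hs' hs
      · rw [h₁.1]; simp only [List.length_append, List.length_nil]; omega
    · refine mul_mem_opSpan hEF (fun u₁ v₁ u₂ v₂ h₁ h₂ s t hs hs' ht => ⟨?_, ?_⟩) hFP hY'
      · rw [h₁.1, List.nil_append]
        exact (h₂.1.mono hs' hs).trans huv
      · rw [h₁.1]; simp only [List.length_append, List.length_nil]; omega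
    · refine mul_mem_opSpan hEF (fun u₁ v₁ u₂ v₂ h₁ h₂ s t hs hs' ht => ⟨?_, ?_⟩) hX' hcR'
      · exact (h₁.1.append_left _).append_right _
      · simp only [List.length_append]; omega
    · refine mul_mem_opSpan hEF (fun u₁ v₁ u₂ v₂ h₁ h₂ s t hs hs' ht => ⟨?_, ?_⟩) hER hFP
      · exact (huv.mono h₁.2.1 h₁.1).append_left _
      · rw [h₂.1] at hs; simp only [List.length_append, List.length_nil] at *; omega
    · refine mul_mem_opSpan hEF (fun u₁ v₁ u₂ v₂ h₁ h₂ s t hs hs' ht => ⟨?_, ?_⟩) hER hX'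
      · exact (huv.mono h₁.2.1 h₁.1).append_left _
      · simp only [List.length_append]; omega
    · refine mul_mem_opSpan hEF (fun u₁ v₁ u₂ v₂ h₁ h₂ s t hs hs' ht => ⟨?_, ?_⟩) hFR hX'
      · rw [h₁.1, List.nil_append]
        exact (h₂.1.mono hs' hs).append_right _
      · rw [h₁.1]; simp only [List.length_append, List.length_nil]; omega
    · refine mul_mem_opSpan hEF (fun u₁ v₁ u₂ v₂ h₁ h₂ s t hs hs' ht => ⟨?_, ?_⟩) hY' hcP'
      · exact (h₁.1.trans huv).append_left _
      · simp only [List.length_append]; omega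
    · rintro s t ⟨h1, h2, h3⟩
      exact ⟨(dom_of_lt_of_length_le h2 h1.le).append_right _, by simp [h1, h3]⟩

lemma IsLyndon.exists_isBracket (hEF : IsTwisted b r E F) (hγ : ∀ x y, diagCoeff b r x y ≠ 0)
    {u : List ι} (hu : IsLyndon u) : ∃ P, IsBracket b E F u P := by
  induction hn : u.length using Nat.strong_induction_on generalizing u with
  | _ n ih =>
    have hpos := List.length_pos_iff.mpr hu.1
    rcases Nat.lt_or_ge 1 u.length with hl | hl
    · obtain ⟨s, t, hs, ht, rfl⟩ := hu.exists_factorization hl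
      have h1 := List.length_pos_iff.mpr hs.1
      have h2 := List.length_pos_iff.mpr ht.1
      rw [List.length_append] at hn
      obtain ⟨P, hP⟩ := ih s.length (by omega) hs rfl
      obtain ⟨R, hR⟩ := ih t.length (by omega) ht rfl
      exact ⟨_, hP.commutator hEF hγ (hu.dom_suffix hs.1 ht.1) hR⟩
    · obtain ⟨x, rfl⟩ := List.length_eq_one_iff.mp (le_antisymm hl hpos)
      exact ⟨_, isBracket_singleton x⟩

end Bracket

/-! ### Lyndon monomials -/

section LyndonMonomial

variable {k V ι : Type*} [Field k] [AddCommGroup V] [Module k V] {b : Module.Basis ι k V}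

lemma prod_map_mem_wordSpan {P : List ι → TensorAlgebra k V} {L : List (List ι)}
    (hP : ∀ l ∈ L, P l ∈ wordSpan b (·.Perm l)) :
    (L.map P).prod ∈ wordSpan b (·.Perm L.flatten) := by
  induction L with
  | nil => exact word_mem_wordSpan (b := b) (w := []) (List.Perm.refl _)
  | cons l L ih =>
    rw [List.map_cons, List.prod_cons]
    exact mul_mem_wordSpan (fun s t hs ht => hs.append ht) (hP l (by simp))
      (ih fun l' hl' => hP l' (by simp [hl']))

variable [LinearOrder ι]

lemma prod_map_sub_word_mem_wordSpan {P : List ι → TensorAlgebra k V} {L : List (List ι)}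
    (hP : ∀ l ∈ L, P l - word b l ∈ wordSpan b fun w => w.length = l.length ∧ l < w) :
    (L.map P).prod - word b L.flatten ∈
      wordSpan b fun w => w.length = L.flatten.length ∧ L.flatten < w := by
  induction L with
  | nil => simp [word_nil]
  | cons l L ih =>
    have hL := ih fun l' hl' => hP l' (by simp [hl'])
    have h1 : ((l :: L).map P).prod - word b (l :: L).flatten =
        (P l - word b l) * (L.map P).prod + word b l * ((L.map P).prod - word b L.flatten) := by
      rw [List.map_cons, List.prod_cons, List.flatten_cons, word_append]; noncomm_ring
    have hL' : (L.map P).prod ∈ wordSpan b fun w => w.length = L.flatten.length := by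
      rw [← sub_add_cancel (L.map P).prod (word b L.flatten)]
      exact add_mem (wordSpan_mono (fun w hw => hw.1) hL) (word_mem_wordSpan rfl)
    rw [h1]
    refine add_mem (mul_mem_wordSpan ?_ (hP l (by simp)) hL')
      (mul_mem_wordSpan (Q₁ := (· = l)) ?_ (word_mem_wordSpan rfl) hL)
    · rintro s t ⟨h1, h2⟩ h3
      exact ⟨by simp only [List.length_append, List.flatten_cons, h1, h3],
        dom_of_lt_of_length_le h2 h1.le L.flatten t⟩
    · rintro s t rfl ⟨h3, h4⟩
      exact ⟨by simp only [List.length_append, List.flatten_cons, h3],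
        (append_lt_append_left_iff _ _ _).mpr h4⟩

end LyndonMonomial

/-! ### Coproducts of Lyndon monomials -/

section Coproduct

variable {k V ι : Type*} [Field k] [AddCommGroup V] [Module k V] [LinearOrder ι]
  {A : Type*} [Ring A] [Algebra k A] {b : Module.Basis ι k V} {E F : TensorAlgebra k V →ₐ[k] A}
  {m : List ι}

/-- The bracketing of a Lyndon word larger than `m` lies in the right tensor factor, up to left
words that dominate `m m m ⋯`. -/
lemma IsBracket.comulHom_sub_mem {l : List ι} {P : TensorAlgebra k V} (hP : IsBracket b E F l P)
    (hl : DomPow m l) : comulHom E F P - F P ∈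
      opSpan b E F fun u v => DomPow m u ∧ u.length + v.length = l.length := by
  have h1 : comulHom E F P - F P = (comulHom E F P - E P - F P) + E P := by abel
  rw [h1]
  refine add_mem (opSpan_mono (fun u v h => ⟨hl.trans h.1, h.2⟩) hP.comul_sub_mem)
    (map_left_mem_opSpan (fun w hw => ⟨hl.mono hw.2 hw.1.length_eq, ?_⟩) hP.mem)
  simp [hw.1.length_eq]

lemma IsBracket.comulHom_sub_sub_mem {P : TensorAlgebra k V} (hP : IsBracket b E F m P) :
    comulHom E F P - E (word b m) - F P ∈
      opSpan b E F fun u v => DomPow m u ∧ u.length + v.length = m.length := by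
  have h1 : comulHom E F P - E (word b m) - F P =
      (comulHom E F P - E P - F P) + E (P - word b m) := by rw [map_sub]; abel
  rw [h1]
  refine add_mem (opSpan_mono (fun u v h => ⟨DomPow.of_dom h.1, h.2⟩) hP.comul_sub_mem)
    (map_left_mem_opSpan (fun w hw => ⟨DomPow.of_dom ?_, ?_⟩) hP.sub_word_mem)
  · exact dom_of_lt_of_length_le hw.2 hw.1.length_eq.le
  · simp [hw.1.length_eq]

variable [Fintype ι] {r : V ⊗[k] V →ₗ[k] V ⊗[k] V}

lemma domPow_mul_mem_opSpan (hEF : IsTwisted b r E F) {n n' n'' : ℕ} (hn : n + n' = n'') {f g : A}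
    (hf : f ∈ opSpan b E F fun u v => DomPow m u ∧ u.length + v.length = n)
    (hg : g ∈ opSpan b E F fun u v => u.length + v.length = n') :
    f * g ∈ opSpan b E F fun u v => DomPow m u ∧ u.length + v.length = n'' := by
  refine mul_mem_opSpan hEF (fun u₁ v₁ u₂ v₂ h₁ h₂ u v hu hu' hv => ⟨h₁.1.append u, ?_⟩) hf hg
  simp only [List.length_append]; omega

lemma mul_domPow_mem_opSpan (hEF : IsTwisted b r E F) {n n' n'' : ℕ} (hn : n + n' = n'') {f g : A}
    (hf : f ∈ opSpan b E F fun u v => (∃ j, u = wordPow m j) ∧ u.length + v.length = n)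
    (hg : g ∈ opSpan b E F fun u v => DomPow m u ∧ u.length + v.length = n') :
    f * g ∈ opSpan b E F fun u v => DomPow m u ∧ u.length + v.length = n'' := by
  refine mul_mem_opSpan hEF (fun u₁ v₁ u₂ v₂ h₁ h₂ u v hu hu' hv => ⟨?_, ?_⟩) hf hg
  · obtain ⟨⟨j, rfl⟩, -⟩ := h₁
    exact (h₂.1.mono hu' hu).wordPow_append j
  · simp only [List.length_append]; omega

lemma comulHom_prod_sub_mem (hEF : IsTwisted b r E F) {P : List ι → TensorAlgebra k V}
    {L : List (List ι)} (hP : ∀ l ∈ L, IsBracket b E F l (P l)) (hL : ∀ l ∈ L, DomPow m l) :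
    comulHom E F (L.map P).prod - F (L.map P).prod ∈
      opSpan b E F fun u v => DomPow m u ∧ u.length + v.length = L.flatten.length := by
  induction L with
  | nil => simp only [List.map_nil, List.prod_nil, map_one, sub_self]; exact zero_mem _
  | cons l L ih =>
    have h1 : comulHom E F ((l :: L).map P).prod - F ((l :: L).map P).prod =
        (comulHom E F (P l) - F (P l)) * comulHom E F (L.map P).prod +
        F (P l) * (comulHom E F (L.map P).prod - F (L.map P).prod) := by
      rw [List.map_cons, List.prod_cons, map_mul, map_mul]; noncomm_ring
    have hPl := hP l (by simp)
    have hL' : (L.map P).prod ∈ wordSpan b fun w => w.length = L.flatten.length :=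
      wordSpan_mono (fun w hw => hw.length_eq) (prod_map_mem_wordSpan fun l' hl' =>
        wordSpan_mono (fun w hw => hw.1) (hP l' (by simp [hl'])).mem)
    rw [h1]
    refine add_mem (domPow_mul_mem_opSpan hEF (by simp) (hPl.comulHom_sub_mem (hL l (by simp)))
      (comulHom_mem_opSpan hEF hL')) (mul_domPow_mem_opSpan hEF (n := l.length) (by simp) ?_
        (ih (fun l' hl' => hP l' (by simp [hl'])) fun l' hl' => hL l' (by simp [hl'])))
    refine map_right_mem_opSpan (fun w hw => ⟨⟨0, (wordPow_zero m).symm⟩, ?_⟩) hPl.mem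
    simp [hw.1.length_eq]

/-- The comultiplication of a monomial `x P ^ e`, where `P` is the bracketing of `m` and `x` lies
in the right tensor factor, up to left words that dominate `m m m ⋯`. The operators `m ⊗ 1` and
`1 ⊗ P` commute up to the factor `q = wordCoeff b r m m`, which makes the coefficients Gaussian
binomials. -/
lemma comulHom_mul_pow_sub_mem (hEF : IsTwisted b r E F) {P x : TensorAlgebra k V} {w : List ι}
    (hP : IsBracket b E F m P) (hx : x ∈ wordSpan b (·.Perm w))
    (hx' : comulHom E F x - F x ∈
      opSpan b E F fun u v => DomPow m u ∧ u.length + v.length = w.length) (e : ℕ) :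
    comulHom E F (x * P ^ e) - ∑ j ∈ Finset.range (e + 1),
      (qBinom (wordCoeff b r m m) e j * wordCoeff b r w m ^ j) •
        (E (word b (wordPow m j)) * F (x * P ^ (e - j))) ∈
      opSpan b E F fun u v => DomPow m u ∧ u.length + v.length = w.length + e * m.length := by
  obtain ⟨q, hq⟩ : ∃ q, q = wordCoeff b r m m := ⟨_, rfl⟩
  obtain ⟨γ, hγ⟩ : ∃ γ, γ = wordCoeff b r w m := ⟨_, rfl⟩
  rw [← hq, ← hγ]
  have hPm : P ∈ wordSpan b (·.Perm m) := wordSpan_mono (fun w hw => hw.1) hP.mem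
  have hxP (i : ℕ) : x * P ^ i ∈ wordSpan b (·.Perm (w ++ wordPow m i)) := by
    induction i with
    | zero => simpa [wordPow_zero] using hx
    | succ i ih =>
      rw [pow_succ, ← mul_assoc, wordPow_succ, ← List.append_assoc]
      exact mul_mem_wordSpan (fun s t hs ht => hs.append ht) ih hPm
  induction e with
  | zero => simpa [wordPow_zero, word_nil, qBinom] using hx'
  | succ e ih =>
    obtain ⟨S, hS⟩ : ∃ S, S = ∑ j ∈ Finset.range (e + 1), (qBinom q e j * γ ^ j) •
        (E (word b (wordPow m j)) * F (x * P ^ (e - j))) := ⟨_, rfl⟩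
    rw [← hS] at ih
    -- multiplying the sum `S` by `m ⊗ 1 + 1 ⊗ P` gives the sum for `e + 1`, by Pascal's rule
    have hsum : ∑ j ∈ Finset.range (e + 1 + 1), (qBinom q (e + 1) j * γ ^ j) •
          (E (word b (wordPow m j)) * F (x * P ^ (e + 1 - j))) =
        S * F P + ∑ j ∈ Finset.range (e + 1), (qBinom q e j * γ ^ j) •
          ((γ * q ^ (e - j)) •
            (E (word b (wordPow m j)) * (E (word b m) * F (x * P ^ (e - j))))) := by
      have h1 : S * F P = ∑ j ∈ Finset.range (e + 1 + 1), (qBinom q e j * γ ^ j) •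
          (E (word b (wordPow m j)) * F (x * P ^ (e + 1 - j))) := by
        rw [Finset.sum_range_succ _ (e + 1), qBinom_eq_zero_of_lt q (Nat.lt_succ_self e), zero_mul,
          zero_smul, add_zero, hS, Finset.sum_mul]
        refine Finset.sum_congr rfl fun j hj => ?_
        have hj' : e + 1 - j = e - j + 1 := by have := Finset.mem_range.mp hj; omega
        rw [smul_mul_assoc, mul_assoc, ← map_mul, mul_assoc, ← pow_succ, hj']
      rw [h1, Finset.sum_range_succ', Finset.sum_range_succ' _ (e + 1), qBinom_zero_right,
        qBinom_zero_right, add_right_comm, ← Finset.sum_add_distrib]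
      congr 1
      refine Finset.sum_congr rfl fun j _ => ?_
      rw [smul_smul, ← mul_assoc (E _), ← map_mul E, ← word_append, ← wordPow_succ,
        Nat.succ_sub_succ, ← add_smul, qBinom_succ_succ]
      congr 1
      ring
    have key : comulHom E F (x * P ^ (e + 1)) - (S * F P + ∑ j ∈ Finset.range (e + 1),
          (qBinom q e j * γ ^ j) • ((γ * q ^ (e - j)) •
            (E (word b (wordPow m j)) * (E (word b m) * F (x * P ^ (e - j)))))) =
        (comulHom E F (x * P ^ e) - S) * comulHom E F P +
        S * (comulHom E F P - E (word b m) - F P) +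
        ∑ j ∈ Finset.range (e + 1), (qBinom q e j * γ ^ j) •
          (E (word b (wordPow m j)) * (F (x * P ^ (e - j)) * E (word b m) -
            (γ * q ^ (e - j)) • (E (word b m) * F (x * P ^ (e - j))))) := by
      have h1 : S * E (word b m) = ∑ j ∈ Finset.range (e + 1), (qBinom q e j * γ ^ j) •
          (E (word b (wordPow m j)) * (F (x * P ^ (e - j)) * E (word b m))) := by
        rw [hS, Finset.sum_mul]
        exact Finset.sum_congr rfl fun j _ => by rw [smul_mul_assoc, mul_assoc]
      simp only [mul_sub, smul_sub, Finset.sum_sub_distrib, ← h1, mul_smul_comm]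
      rw [pow_succ, ← mul_assoc, map_mul]
      noncomm_ring
    rw [hsum, key]
    refine add_mem (add_mem ?_ ?_) (sum_mem fun j hj => Submodule.smul_mem _ _ ?_)
    · refine domPow_mul_mem_opSpan hEF ?_ ih (comulHom_mem_opSpan hEF
        (wordSpan_mono (fun w hw => hw.length_eq) hPm))
      ring
    · refine mul_domPow_mem_opSpan hEF (n := w.length + e * m.length) (by ring) ?_
        hP.comulHom_sub_sub_mem
      rw [hS]
      refine sum_mem fun j hj => Submodule.smul_mem _ _ (left_mul_mem_opSpan
        (Q₁ := fun u v => u = [] ∧ v.length = w.length + (e - j) * m.length) _ ?_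
          (map_right_mem_opSpan (fun w' hw' => ⟨rfl, ?_⟩) (hxP (e - j))))
      · rintro u v ⟨rfl, hv⟩
        refine ⟨⟨j, by simp⟩, ?_⟩
        obtain ⟨d, rfl⟩ := Nat.exists_eq_add_of_le (Nat.lt_succ_iff.mp (Finset.mem_range.mp hj))
        rw [hv, List.append_nil, length_wordPow, Nat.add_sub_cancel_left]
        ring
      · rw [hw'.length_eq, List.length_append, length_wordPow]
    · have hc : γ * q ^ (e - j) = wordCoeff b r (w ++ wordPow m (e - j)) m := by
        rw [wordCoeff_append_left, wordCoeff_wordPow_left, hγ, hq]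
      rw [hc]
      refine left_mul_mem_opSpan _ ?_ (map_mul_map_sub_mem_opSpan hEF (hxP (e - j))
        (word_mem_wordSpan ⟨rfl, le_rfl⟩))
      rintro u v ⟨h1, h2, h3⟩
      refine ⟨(DomPow.of_dom (dom_of_lt_of_length_le h2 h1.le)).wordPow_append j, ?_⟩
      obtain ⟨d, rfl⟩ := Nat.exists_eq_add_of_le (Nat.lt_succ_iff.mp (Finset.mem_range.mp hj))
      rw [List.length_append, h1, h3, List.length_append, length_wordPow, length_wordPow,
        Nat.add_sub_cancel_left]
      ring

end Coproduct

/-! ### Functionals on the left tensor factor -/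

section Evaluation

variable {k V ι : Type*} [Field k] [AddCommGroup V] [Module k V]

attribute [local instance] opRing

/-- The map `f ↦ (φ ⊗ id) (f (1 ⊗ 1))` on the operators on `T(V) ⊗ T(V)`. -/
def evalLeft (φ : TensorAlgebra k V →ₗ[k] k) :
    Module.End k (TensorAlgebra k V ⊗[k] TensorAlgebra k V) →ₗ[k] TensorAlgebra k V :=
  (TensorProduct.lid k (TensorAlgebra k V)).toLinearMap ∘ₗ φ.rTensor (TensorAlgebra k V) ∘ₗ
    LinearMap.applyₗ ((1 : TensorAlgebra k V) ⊗ₜ[k] (1 : TensorAlgebra k V))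

lemma evalLeft_opLeft_mul_opRight (φ : TensorAlgebra k V →ₗ[k] k)
    (r : V ⊗[k] V →ₗ[k] V ⊗[k] V) (u v : TensorAlgebra k V) :
    evalLeft φ (opLeft k V u * opRight r v) = φ u • v := by
  rw [evalLeft, LinearMap.comp_apply, LinearMap.comp_apply, LinearMap.applyₗ_apply_apply,
    opLeft_mul_opRight_apply_one]
  simp

lemma evalLeft_comulHom_mem {c : V ⊗[k] V →ₗ[k] V ⊗[k] V} {I : Ideal (TensorAlgebra k V)}
    (hI : IsBraidedBiideal c I) {φ : TensorAlgebra k V →ₗ[k] k} (hφ : ∀ a ∈ I, φ a = 0)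
    {a : TensorAlgebra k V} (ha : a ∈ I) :
    evalLeft φ (comulHom (opLeft k V) (opRight c) a) ∈ I.restrictScalars k := by
  have h1 := hI.comul_mem a ha
  rw [comul_eq_comulHom] at h1
  rw [evalLeft, LinearMap.comp_apply, LinearMap.comp_apply, LinearMap.applyₗ_apply_apply]
  obtain ⟨_, ⟨x, rfl⟩, _, ⟨y, rfl⟩, hxy⟩ := Submodule.mem_sup.mp h1
  rw [← hxy, map_add, map_add]
  clear hxy
  refine add_mem ?_ ?_
  · induction x with
    | zero => simp
    | add x x' hx hx' => simp only [map_add]; exact add_mem hx hx'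
    | tmul s t => simpa using Submodule.smul_mem (I.restrictScalars k) (φ s) t.2
  · induction y with
    | zero => simp
    | add x x' hx hx' => simp only [map_add]; exact add_mem hx hx'
    | tmul s t => simp [hφ s s.2]

variable [LinearOrder ι] {b : Module.Basis ι k V} {r : V ⊗[k] V →ₗ[k] V ⊗[k] V}
  {φ : TensorAlgebra k V →ₗ[k] k}

/-- The functional `φ` vanishes on short words, so that terms of total degree less than `n` have an
image of degree less than `n` minus the degree of `u`. -/
lemma evalLeft_mem_of_length_lt {u : List ι} {n n' : ℕ} (hn : n' < n)
    (hφ : ∀ w, StdLT u w → φ (word b w) = 0)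
    {f : Module.End k (TensorAlgebra k V ⊗[k] TensorAlgebra k V)}
    (hf : f ∈ opSpan b (opLeft k V) (opRight r) fun u v => u.length + v.length = n') :
    evalLeft φ f ∈ wordSpan b fun w => w.length + u.length < n := by
  refine map_mem_of_mem_opSpan (evalLeft φ) _ (fun s t hst => ?_) hf
  rw [evalLeft_opLeft_mul_opRight]
  rcases lt_or_ge s.length u.length with h | h
  · rw [hφ s (Or.inl h), zero_smul]; exact zero_mem _
  · exact Submodule.smul_mem _ _ (word_mem_wordSpan (by omega))

lemma evalLeft_mem_of_domPow {m : List ι} {e n : ℕ}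
    (hφ : ∀ w, StdLT (wordPow m e) w → φ (word b w) = 0)
    {f : Module.End k (TensorAlgebra k V ⊗[k] TensorAlgebra k V)}
    (hf : f ∈ opSpan b (opLeft k V) (opRight r) fun u v => DomPow m u ∧ u.length + v.length = n) :
    evalLeft φ f ∈ wordSpan b fun w => w.length + (wordPow m e).length < n := by
  refine map_mem_of_mem_opSpan (evalLeft φ) _ (fun s t hst => ?_) hf
  rw [evalLeft_opLeft_mul_opRight]
  rcases le_or_gt s.length (wordPow m e).length with h | h
  · rw [hφ s ?_, zero_smul]
    · exact zero_mem _
    · rcases h.lt_or_eq with h | h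
      · exact Or.inl h
      · exact Or.inr ⟨h.symm, hst.1.lt h⟩
  · exact Submodule.smul_mem _ _ (word_mem_wordSpan (by omega))

/-- Applying a functional with leading word `m ^ i` to the left tensor factor of the coproduct of a
Lyndon monomial all of whose factors are at least `m` removes `i` of the factors `m`. -/
lemma evalLeft_comulHom_prod_sub_mem [Fintype ι] (hr : IsLeftTriangular b r) {m : List ι}
    (hm : IsLyndon m) {P : List ι → TensorAlgebra k V}
    (hP : ∀ l, IsLyndon l → IsBracket b (opLeft k V) (opRight r) l (P l)) {L : List (List ι)}
    (hL : ∀ l ∈ L, IsLyndon l) (hmL : ∀ l ∈ L, m < l) (e i : ℕ)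
    (hφ : ∀ w, StdLT (wordPow m i) w → φ (word b w) = 0) :
    evalLeft φ (comulHom (opLeft k V) (opRight r) ((L ++ List.replicate e m).map P).prod) -
      (qBinom (wordCoeff b r m m) e i * wordCoeff b r L.flatten m ^ i *
        φ (word b (wordPow m i))) • ((L ++ List.replicate (e - i) m).map P).prod ∈
      wordSpan b fun w => w.length + (wordPow m i).length <
        (L ++ List.replicate e m).flatten.length := by
  have hEF := hr.isTwisted
  have hprod (j : ℕ) : ((L ++ List.replicate j m).map P).prod = (L.map P).prod * P m ^ j := by
    simp
  have hlen : (L ++ List.replicate e m).flatten.length = L.flatten.length + e * m.length := by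
    rw [List.flatten_append, List.length_append]
    exact congrArg _ (length_wordPow m e)
  have hx : (L.map P).prod ∈ wordSpan b (·.Perm L.flatten) :=
    prod_map_mem_wordSpan fun l hl => wordSpan_mono (fun w hw => hw.1) (hP l (hL l hl)).mem
  have hPm : P m ∈ wordSpan b (·.Perm m) := wordSpan_mono (fun w hw => hw.1) (hP m hm).mem
  have h1 := evalLeft_mem_of_domPow hφ (comulHom_mul_pow_sub_mem hEF (hP m hm) hx
    (comulHom_prod_sub_mem hEF (fun l hl => hP l (hL l hl))
      fun l hl => (hL l hl).domPow hm.1 (hmL l hl)) e)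
  rw [hprod, hprod, hlen]
  rw [map_sub, map_sum] at h1
  simp only [map_smul, evalLeft_opLeft_mul_opRight] at h1
  have h2 : ∑ j ∈ Finset.range (e + 1),
        (qBinom (wordCoeff b r m m) e j * wordCoeff b r L.flatten m ^ j) •
          φ (word b (wordPow m j)) • ((L.map P).prod * P m ^ (e - j)) -
      (qBinom (wordCoeff b r m m) e i * wordCoeff b r L.flatten m ^ i *
        φ (word b (wordPow m i))) • ((L.map P).prod * P m ^ (e - i)) ∈
      wordSpan b fun w => w.length + (wordPow m i).length < L.flatten.length + e * m.length := by
    have hmpos := List.length_pos_iff.mpr hm.1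
    have h3 : ∀ j ∈ Finset.range (e + 1), j ≠ i →
        (qBinom (wordCoeff b r m m) e j * wordCoeff b r L.flatten m ^ j) •
          φ (word b (wordPow m j)) • ((L.map P).prod * P m ^ (e - j)) ∈
        wordSpan b fun w => w.length + (wordPow m i).length < L.flatten.length + e * m.length := by
      intro j hj hji
      rcases hji.lt_or_gt with h | h
      · rw [hφ _ (Or.inl ?_), zero_smul, smul_zero]
        · exact zero_mem _
        · rw [length_wordPow, length_wordPow]; exact Nat.mul_lt_mul_of_pos_right h hmpos
      · have h4 : (L.map P).prod * P m ^ (e - j) ∈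
            wordSpan b (·.Perm (L ++ List.replicate (e - j) m).flatten) := by
          rw [← hprod]
          refine prod_map_mem_wordSpan fun l hl => ?_
          rcases List.mem_append.mp hl with hl | hl
          · exact wordSpan_mono (fun w hw => hw.1) (hP l (hL l hl)).mem
          · rw [List.eq_of_mem_replicate hl]; exact hPm
        refine Submodule.smul_mem _ _ (Submodule.smul_mem _ _ (wordSpan_mono (fun w hw => ?_) h4))
        have h5 : (e - j) * m.length + i * m.length < e * m.length := by
          rw [← add_mul]
          exact Nat.mul_lt_mul_of_pos_right (by have := Finset.mem_range.mp hj; omega) hmpos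
        have h6 : (List.replicate (e - j) m).flatten.length = (e - j) * m.length :=
          length_wordPow m (e - j)
        rw [hw.length_eq, List.flatten_append, List.length_append, h6, length_wordPow]
        omega
    by_cases hi : i ∈ Finset.range (e + 1)
    · rw [← Finset.add_sum_erase _ _ hi, smul_smul, add_sub_cancel_left]
      exact sum_mem fun j hj => h3 j (Finset.mem_of_mem_erase hj) (Finset.ne_of_mem_erase hj)
    · rw [qBinom_eq_zero_of_lt _ (by simpa using hi), zero_mul, zero_mul, zero_smul, sub_zero]
      exact sum_mem fun j hj => h3 j hj (fun h => hi (h ▸ hj))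
  simpa using add_mem h1 h2

end Evaluation

/-! ### The diagonal component -/

section Diagonal

variable {k V ι : Type*} [Field k] [AddCommGroup V] [Module k V]

lemma opRight_diagComponent_mul (b : Module.Basis ι k V) (r : V ⊗[k] V →ₗ[k] V ⊗[k] V) (x y : ι) :
    opRight (diagComponent b r) (word b [x]) * opLeft k V (word b [y]) =
      wordCoeff b r [x] [y] •
        (opLeft k V (word b [y]) * opRight (diagComponent b r) (word b [x])) := by
  have hx (x : ι) : word b [x] = TensorAlgebra.ι k (b x) := by simp [word]
  have hd : diagComponent b r (b x ⊗ₜ b y) = diagCoeff b r x y • (b y ⊗ₜ b x) := by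
    rw [← Module.Basis.tensorProduct_apply, diagComponent, Module.Basis.constr_basis]
  rw [hx, hx, opRight_ι, stepLeft_mul_opLeft_ι, hd, wordCoeff_singleton]
  simp

lemma extend_diagComponent_word (b : Module.Basis ι k V) (r : V ⊗[k] V →ₗ[k] V ⊗[k] V)
    (u v : List ι) : extend (diagComponent b r) (word b u ⊗ₜ word b v) =
      wordCoeff b r u v • (word b v ⊗ₜ word b u) := by
  have h1 (x : ι) (v : List ι) : opRight (diagComponent b r) (word b [x]) * opLeft k V (word b v) =
      wordCoeff b r [x] v •
        (opLeft k V (word b v) * opRight (diagComponent b r) (word b [x])) := by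
    induction v with
    | nil => rw [word_nil, map_one, wordCoeff_nil_right, one_smul, mul_one, one_mul]
    | cons y v ih =>
      rw [← List.singleton_append (x := y), word_append, map_mul, ← mul_assoc,
        opRight_diagComponent_mul, smul_mul_assoc, mul_assoc, ih, mul_smul_comm, smul_smul,
        ← wordCoeff_append_right, mul_assoc]
  have h2 : opRight (diagComponent b r) (word b u) * opLeft k V (word b v) =
      wordCoeff b r u v •
        (opLeft k V (word b v) * opRight (diagComponent b r) (word b u)) := by
    induction u with
    | nil => rw [word_nil, map_one, wordCoeff_nil_left, one_smul, mul_one, one_mul]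
    | cons x u ih =>
      rw [← List.singleton_append (x := x), word_append, map_mul, mul_assoc, ih, mul_smul_comm,
        ← mul_assoc, h1, smul_mul_assoc, smul_smul, mul_comm (wordCoeff b r u v),
        ← wordCoeff_append_left, mul_assoc]
  have h3 := congrArg (fun f => f (1 ⊗ₜ[k] 1)) h2
  simp only [LinearMap.smul_apply, opLeft_mul_opRight_apply_one] at h3
  rw [← h3, Module.End.mul_apply, opLeft_tmul, mul_one, opRight_tmul_one]

variable [Fintype ι] [LinearOrder ι]

/-- The operator that turns `x ⊗ y` into the flip of `c (x ⊗ y)` preserves the subspace of `V ⊗ V`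
spanned by the `x ⊗ z` with `z > y`, hence maps it onto itself. If the coefficient were zero,
`x ⊗ y` would be mapped into it as well. -/
lemma diagCoeff_ne_zero {b : Module.Basis ι k V} {c : V ⊗[k] V ≃ₗ[k] V ⊗[k] V}
    (htri : IsLeftTriangular b c.toLinearMap) (x y : ι) :
    diagCoeff b c.toLinearMap x y ≠ 0 := by
  intro h0
  obtain ⟨γ, w, h⟩ := htri
  rw [diagCoeff_eq b _ γ w h] at h0
  have hfin : FiniteDimensional k V := Module.Finite.of_basis b
  let e : V ⊗[k] V ≃ₗ[k] V ⊗[k] V := c.trans (TensorProduct.comm k V V)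
  let S : Submodule k (V ⊗[k] V) := ⨆ z : {z : ι // y < z},
    LinearMap.range ((TensorProduct.mk k V V).flip (b z))
  have hS (z : ι) (hz : y < z) (v : V) : v ⊗ₜ[k] b z ∈ S :=
    Submodule.mem_iSup_of_mem (p := fun z : {z : ι // y < z} =>
      LinearMap.range ((TensorProduct.mk k V V).flip (b z))) ⟨z, hz⟩ ⟨v, rfl⟩
  have he (x z : ι) : e (b x ⊗ₜ b z) = γ x z • (b x ⊗ₜ b z) +
      ∑ t ∈ Finset.univ.filter (fun t => z < t), w x z t ⊗ₜ b t := by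
    have h1 := h x z
    rw [LinearEquiv.coe_coe] at h1
    simp [e, h1]
  have hle : S.map e.toLinearMap ≤ S := by
    rw [Submodule.map_le_iff_le_comap]
    refine iSup_le fun z => ?_
    rintro _ ⟨v, rfl⟩
    simp only [LinearMap.flip_apply, TensorProduct.mk_apply, Submodule.mem_comap,
      LinearEquiv.coe_coe]
    rw [← b.sum_repr v, TensorProduct.sum_tmul, map_sum]
    refine sum_mem fun i _ => ?_
    rw [← TensorProduct.smul_tmul', map_smul, he]
    refine Submodule.smul_mem _ _ (add_mem (Submodule.smul_mem _ _ (hS z z.2 _))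
      (sum_mem fun t ht => hS t (z.2.trans (Finset.mem_filter.mp ht).2) _))
  have heq : S.map e.toLinearMap = S :=
    Submodule.eq_of_le_of_finrank_eq hle (LinearEquiv.finrank_map_eq e S)
  have hmem : e (b x ⊗ₜ b y) ∈ S := by
    rw [he, h0, zero_smul, zero_add]
    exact sum_mem fun t ht => hS t (Finset.mem_filter.mp ht).2 _
  rw [← heq] at hmem
  obtain ⟨s, hs, hse⟩ := hmem
  have hxy : b x ⊗ₜ[k] b y ∈ S := by
    rwa [e.injective (show e s = e (b x ⊗ₜ[k] b y) from hse)] at hs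
  -- the coordinate at `x ⊗ y` vanishes on the subspace
  have hker : S ≤ LinearMap.ker ((b.tensorProduct b).coord (x, y)) := by
    refine iSup_le fun z => ?_
    rintro _ ⟨v, rfl⟩
    simp [Finsupp.single_eq_of_ne z.2.ne]
  have := hker hxy
  simp at this

end Diagonal

/-! ### Normal words -/

section Normal

variable {k V ι : Type*} [Field k] [AddCommGroup V] [Module k V] [LinearOrder ι]

/-- A word is normal modulo `I` if it is not the leading word of an element of `I`, the leading
word of an element being its smallest word in the standard order. -/
def IsNormal (b : Module.Basis ι k V) (I : Ideal (TensorAlgebra k V)) (w : List ι) : Prop :=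
  word b w ∉ spanGT b w ⊔ I.restrictScalars k

variable {b : Module.Basis ι k V} {I : Ideal (TensorAlgebra k V)}

lemma StdLT.append {u w : List ι} (h : StdLT u w) (p s : List ι) :
    StdLT (p ++ u ++ s) (p ++ w ++ s) := by
  rcases h with h | ⟨h1, h2⟩
  · left; simp only [List.length_append]; omega
  · right
    refine ⟨by simp only [List.length_append, h1], ?_⟩
    rw [List.append_assoc, List.append_assoc, append_lt_append_left_iff]
    exact dom_of_lt_of_length_le h2 h1.ge s s

lemma IsNormal.of_append (hI : I.IsTwoSided) {p u s : List ι} (h : IsNormal b I (p ++ u ++ s)) :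
    IsNormal b I u := by
  intro hu
  refine h ?_
  obtain ⟨g, hg, a, ha, hga⟩ := Submodule.mem_sup.mp hu
  rw [word_append, word_append, ← hga, mul_add, add_mul]
  refine add_mem (Submodule.mem_sup_left ?_) (Submodule.mem_sup_right ?_)
  · exact mul_mem_wordSpan (Q₁ := fun w => ∃ w', StdLT u w' ∧ w = p ++ w') (Q₂ := (· = s))
      (by rintro _ _ ⟨w', hw', rfl⟩ rfl; exact hw'.append p _)
      (mul_mem_wordSpan (Q₁ := (· = p)) (by rintro _ w' rfl hw'; exact ⟨w', hw', rfl⟩)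
        (word_mem_wordSpan rfl) hg) (word_mem_wordSpan rfl)
  · exact hI.mul_mem_of_left _ (I.mul_mem_left _ ha)

lemma IsNormal.exists_functional {w : List ι} (h : IsNormal b I w) :
    ∃ φ : TensorAlgebra k V →ₗ[k] k, φ (word b w) ≠ 0 ∧ (∀ w', StdLT w w' → φ (word b w') = 0) ∧
      ∀ a ∈ I, φ a = 0 := by
  obtain ⟨φ, h1, h2⟩ := Submodule.exists_le_ker_of_notMem h
  exact ⟨φ, h1, fun w' hw' => h2 (Submodule.mem_sup_left (word_mem_wordSpan hw')),
    fun a ha => h2 (Submodule.mem_sup_right ha)⟩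

/-- Modulo `I` and shorter words, a word `w` is a combination of the elements with normal leading
words that are at least `w`. -/
lemma word_mem_span_normal [Finite ι] {B : List ι → TensorAlgebra k V}
    (hB : ∀ w, B w - word b w ∈ wordSpan b fun w' => w'.length = w.length ∧ w < w') {n : ℕ}
    {w : List ι} (hw : w.length = n) :
    word b w ∈ Submodule.span k (B '' {w' | w'.length = n ∧ w ≤ w' ∧ IsNormal b I w'}) ⊔
      (wordSpan b (fun w' => w'.length < n) ⊔ I.restrictScalars k) := by
  by_contra hcon
  obtain ⟨w, ⟨hw, hbad⟩, hmax⟩ := Set.exists_max_image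
    {w : List ι | w.length = n ∧ word b w ∉
      Submodule.span k (B '' {w' | w'.length = n ∧ w ≤ w' ∧ IsNormal b I w'}) ⊔
        (wordSpan b (fun w' => w'.length < n) ⊔ I.restrictScalars k)} id
    ((List.finite_length_eq ι n).subset fun w hw => hw.1) ⟨w, hw, hcon⟩
  have hgt (w' : List ι) (h1 : w'.length = n) (h2 : w < w') : word b w' ∈
      Submodule.span k (B '' {w' | w'.length = n ∧ w ≤ w' ∧ IsNormal b I w'}) ⊔
        (wordSpan b (fun w' => w'.length < n) ⊔ I.restrictScalars k) := by
    by_contra h3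
    have h4 : word b w' ∉
        Submodule.span k (B '' {w'' | w''.length = n ∧ w' ≤ w'' ∧ IsNormal b I w''}) ⊔
        (wordSpan b (fun w' => w'.length < n) ⊔ I.restrictScalars k) := by
      refine fun h4 => h3 ((sup_le_sup_right (Submodule.span_mono (Set.image_mono ?_)) _ :
        (_ : Submodule k (TensorAlgebra k V)) ≤ _) h4)
      exact fun w'' hw'' => ⟨hw''.1, h2.le.trans hw''.2.1, hw''.2.2⟩
    exact absurd h2 (not_lt.mpr (hmax w' ⟨h1, h4⟩))
  by_cases hn : IsNormal b I w
  · refine hbad ?_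
    rw [← sub_sub_cancel (B w) (word b w)]
    refine sub_mem (Submodule.mem_sup_left (Submodule.subset_span ⟨w, ⟨hw, le_rfl, hn⟩, rfl⟩)) ?_
    exact wordSpan_le (fun w' hw' => hgt w' (hw'.1.trans hw) hw'.2) (hB w)
  · refine hbad (sup_le (wordSpan_le fun w' hw' => ?_) (le_sup_of_le_right le_sup_right)
      (not_not.mp hn))
    rcases hw' with h | ⟨h1, h2⟩
    · exact Submodule.mem_sup_right (Submodule.mem_sup_left (word_mem_wordSpan (hw ▸ h)))
    · exact hgt w' (h1.symm.trans hw) h2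

end Normal

/-! ### Relations between Lyndon monomials -/

section Count

variable {ι : Type*} [LinearOrder ι]

lemma count_eq_of_eq_append_replicate {L L' : List (List ι)} {m : List ι} {e : ℕ}
    (h : L = L' ++ List.replicate e m) (hL' : ∀ l ∈ L', m < l) : L.count m = e := by
  rw [h, List.count_append, List.count_replicate_self, List.count_eq_zero.mpr, zero_add]
  exact fun hm => lt_irrefl _ (hL' m hm)

end Count

section Relation

variable {k V ι : Type*} [Field k] [AddCommGroup V] [Module k V] [Fintype ι] [LinearOrder ι]
  {b : Module.Basis ι k V} {r : V ⊗[k] V →ₗ[k] V ⊗[k] V} {I : Ideal (TensorAlgebra k V)}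

attribute [local instance] opRing

/-- In a relation between Lyndon monomials modulo `I` and shorter words, in which all Lyndon
factors are at least `m`, a monomial with `e` factors `m` can occur only if the Gaussian binomial
coefficient `(e choose i)_q` vanishes. Indeed, a functional with leading word `m ^ i`, applied to
the left factor of the coproduct, would otherwise turn the relation into one whose leading word is
a proper beginning of one of the words, and such a beginning is normal. -/
lemma qBinom_count_eq_zero (hr : IsLeftTriangular b r) (hγ : ∀ x y, diagCoeff b r x y ≠ 0)
    (hI : IsBraidedBiideal r I) {P : List ι → TensorAlgebra k V}
    (hP : ∀ l, IsLyndon l → IsBracket b (opLeft k V) (opRight r) l (P l))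
    {fac : List ι → List (List ι)} (hflat : ∀ w, (fac w).flatten = w)
    (hlyn : ∀ w, ∀ l ∈ fac w, IsLyndon l) (hsort : ∀ w, (fac w).Pairwise (· ≥ ·))
    {n : ℕ} {α : List ι →₀ k} (hlen : ∀ w ∈ α.support, w.length = n)
    (hα : ∑ w ∈ α.support, α w • ((fac w).map P).prod ∈
      wordSpan b (fun w => w.length < n) ⊔ I.restrictScalars k)
    {m : List ι} (hm : IsLyndon m) {i : ℕ} (hmi : IsNormal b I (wordPow m i))
    (hmin : ∀ w ∈ α.support, ∀ l ∈ fac w, m ≤ l)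
    (hnorm : ∀ w ∈ α.support, i ≤ (fac w).count m → ∀ y, w = y ++ wordPow m i → IsNormal b I y)
    {w : List ι} (hw : w ∈ α.support) :
    qBinom (wordCoeff b r m m) ((fac w).count m) i = 0 := by
  have hEF := hr.isTwisted
  obtain ⟨φ, hφ1, hφ0, hφI⟩ := hmi.exists_functional
  -- the decomposition of each word of the relation into a word without `m` and a power of `m`
  have hdec : ∀ w, ∃ L, w ∈ α.support → fac w = L ++ List.replicate ((fac w).count m) m ∧
      ∀ l ∈ L, m < l := by
    intro w
    by_cases hw : w ∈ α.support
    · obtain ⟨L, e, h1, h2⟩ := exists_eq_append_replicate (hsort w) (hmin w hw)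
      exact ⟨L, fun _ => ⟨by rwa [count_eq_of_eq_append_replicate h1 h2], h2⟩⟩
    · exact ⟨[], fun h => absurd h hw⟩
  choose L hL using hdec
  obtain ⟨β, hβ⟩ : ∃ β : List ι → k, β = fun w =>
      qBinom (wordCoeff b r m m) ((fac w).count m) i * wordCoeff b r (L w).flatten m ^ i *
        φ (word b (wordPow m i)) := ⟨_, rfl⟩
  obtain ⟨M, hM⟩ : ∃ M : List ι → List (List ι),
      M = fun w => L w ++ List.replicate ((fac w).count m - i) m := ⟨_, rfl⟩
  have hLlyn (w : List ι) (hw : w ∈ α.support) : ∀ l ∈ L w, IsLyndon l := fun l hl =>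
    hlyn w l (by rw [(hL w hw).1]; exact List.mem_append_left _ hl)
  have heval (w : List ι) (hw : w ∈ α.support) :
      evalLeft φ (comulHom (opLeft k V) (opRight r) ((fac w).map P).prod) -
        β w • ((M w).map P).prod ∈
      wordSpan b fun w => w.length + (wordPow m i).length < n := by
    have h1 := evalLeft_comulHom_prod_sub_mem hr hm hP (hLlyn w hw) (hL w hw).2
      ((fac w).count m) i hφ0
    rw [← (hL w hw).1, hflat, hlen w hw] at h1
    rw [hβ, hM]
    exact h1
  -- the image of the relation
  have hrel : ∑ w ∈ α.support, α w • β w • ((M w).map P).prod ∈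
      wordSpan b (fun w => w.length + (wordPow m i).length < n) ⊔ I.restrictScalars k := by
    have h1 : evalLeft φ (comulHom (opLeft k V) (opRight r)
        (∑ w ∈ α.support, α w • ((fac w).map P).prod)) ∈
        wordSpan b (fun w => w.length + (wordPow m i).length < n) ⊔ I.restrictScalars k := by
      obtain ⟨x, hx, a, ha, hxa⟩ := Submodule.mem_sup.mp hα
      rw [← hxa, map_add, map_add]
      refine add_mem (Submodule.mem_sup_left ?_)
        (Submodule.mem_sup_right (evalLeft_comulHom_mem hI hφI ha))
      exact map_mem_of_mem_wordSpan (evalLeft φ ∘ₗ (comulHom (opLeft k V) (opRight r)).toLinearMap)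
        _ (fun w hw => evalLeft_mem_of_length_lt hw hφ0 (comulHom_word_mem_opSpan hEF w)) hx
    rw [map_sum, map_sum] at h1
    have h2 : ∑ w ∈ α.support, α w •
        (evalLeft φ (comulHom (opLeft k V) (opRight r) ((fac w).map P).prod) -
        β w • ((M w).map P).prod) ∈
        wordSpan b (fun w => w.length + (wordPow m i).length < n) ⊔ I.restrictScalars k :=
      Submodule.mem_sup_left (sum_mem fun w hw => Submodule.smul_mem _ _ (heval w hw))
    simp only [map_smul] at h1
    simp only [smul_sub, Finset.sum_sub_distrib] at h2
    simpa using sub_mem h1 h2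
  by_contra hne
  have hβw : ∀ w, qBinom (wordCoeff b r m m) ((fac w).count m) i ≠ 0 → β w ≠ 0 := by
    intro w hw
    rw [hβ]
    exact mul_ne_zero (mul_ne_zero hw (pow_ne_zero _ (wordCoeff_ne_zero b r hγ _ _))) hφ1
  have hle (w : List ι) (hw' : β w ≠ 0) : i ≤ (fac w).count m := by
    by_contra hlt
    refine hw' ?_
    rw [hβ]
    simp only [qBinom_eq_zero_of_lt _ (not_le.mp hlt), zero_mul]
  have hsplit (w : List ι) (hw : w ∈ α.support) (hw' : β w ≠ 0) :
      w = (M w).flatten ++ wordPow m i := by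
    have h1 := hflat w
    rw [(hL w hw).1, ← Nat.sub_add_cancel (hle w hw'), ← List.replicate_append_replicate,
      ← List.append_assoc, List.flatten_append] at h1
    rw [hM]
    exact h1.symm
  classical
  obtain ⟨w₁, hw₁, hmin₁⟩ := Finset.exists_min_image (α.support.filter (fun w => β w ≠ 0)) id
    ⟨w, Finset.mem_filter.mpr ⟨hw, hβw w hne⟩⟩
  rw [Finset.mem_filter] at hw₁
  have hw₁s := hsplit w₁ hw₁.1 hw₁.2
  refine hnorm w₁ hw₁.1 (hle w₁ hw₁.2) _ hw₁s ?_
  have hprodM (w : List ι) (hw : w ∈ α.support) : ((M w).map P).prod - word b (M w).flatten ∈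
      wordSpan b fun w' => w'.length = (M w).flatten.length ∧ (M w).flatten < w' := by
    refine prod_map_sub_word_mem_wordSpan fun l hl => ?_
    have hl' : IsLyndon l := by
      rw [hM] at hl
      rcases List.mem_append.mp hl with hl | hl
      · exact hLlyn w hw l hl
      · rw [List.eq_of_mem_replicate hl]; exact hm
    exact wordSpan_mono (fun w' h => ⟨h.1.length_eq, h.2⟩) (hP l hl').sub_word_mem
  have hlenM : (M w₁).flatten.length + (wordPow m i).length = n := by
    rw [← List.length_append, ← hw₁s, hlen w₁ hw₁.1]
  have hlow : wordSpan b (fun w => w.length + (wordPow m i).length < n) ≤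
      spanGT b (M w₁).flatten :=
    wordSpan_mono fun w hw => Or.inl (by omega)
  have hother (w : List ι) (hw : w ∈ α.support.erase w₁) : α w • β w • ((M w).map P).prod ∈
      spanGT b (M w₁).flatten := by
    rw [Finset.mem_erase] at hw
    by_cases hβ0 : β w = 0
    · rw [hβ0, zero_smul, smul_zero]; exact zero_mem _
    have hws := hsplit w hw.2 hβ0
    have hlt : w₁ < w := lt_of_le_of_ne (hmin₁ w (Finset.mem_filter.mpr ⟨hw.2, hβ0⟩)) hw.1.symm
    have hlen' : (M w).flatten.length = (M w₁).flatten.length := by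
      have h1 := hlen w hw.2
      rw [hws, List.length_append] at h1
      omega
    have hlt' : (M w₁).flatten < (M w).flatten := by
      by_contra hcon
      rw [hws, hw₁s] at hlt
      exact absurd hlt (not_lt.mpr (append_le_append (not_lt.mp hcon) le_rfl hlen'.symm))
    refine Submodule.smul_mem _ _ (Submodule.smul_mem _ _ ?_)
    rw [← sub_add_cancel ((M w).map P).prod (word b (M w).flatten)]
    exact add_mem (wordSpan_mono (fun w' h => Or.inr ⟨(h.1.trans hlen').symm, hlt'.trans h.2⟩)
      (hprodM w hw.2)) (word_mem_wordSpan (Or.inr ⟨hlen'.symm, hlt'⟩))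
  have h1 : (α w₁ * β w₁) • word b (M w₁).flatten ∈
      spanGT b (M w₁).flatten ⊔ I.restrictScalars k := by
    have h2 := sup_le_sup_right hlow _ hrel
    rw [← Finset.add_sum_erase _ _ hw₁.1] at h2
    have h3 : (α w₁ * β w₁) • word b (M w₁).flatten =
        (α w₁ • β w₁ • ((M w₁).map P).prod +
          ∑ w ∈ α.support.erase w₁, α w • β w • ((M w).map P).prod) -
        ∑ w ∈ α.support.erase w₁, α w • β w • ((M w).map P).prod -
        (α w₁ * β w₁) • (((M w₁).map P).prod - word b (M w₁).flatten) := by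
      rw [add_sub_cancel_right, smul_sub, smul_smul, sub_sub_cancel]
    rw [h3]
    refine sub_mem (sub_mem h2 (Submodule.mem_sup_left (sum_mem hother)))
      (Submodule.mem_sup_left (Submodule.smul_mem _ _ ?_))
    exact wordSpan_mono (fun w' h => Or.inr ⟨h.1.symm, h.2⟩) (hprodM w₁ hw₁.1)
  exact (Submodule.smul_mem_iff _
    (mul_ne_zero (Finsupp.mem_support_iff.mp hw₁.1) hw₁.2)).mp h1

/-- If `v ^ h` is the first power of the Lyndon word `v` that is not normal, all proper Gaussian
binomial coefficients of `h` vanish. -/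
lemma qBinom_eq_zero_of_height {c : V ⊗[k] V ≃ₗ[k] V ⊗[k] V}
    (htri : IsLeftTriangular b c.toLinearMap) (hI : IsBraidedBiideal c.toLinearMap I)
    {v : List ι} (hv : IsLyndon v) {h : ℕ} (hh : ¬ IsNormal b I (wordPow v h))
    (hlt : ∀ i, 0 < i → i < h → IsNormal b I (wordPow v i)) {i : ℕ} (hi : 0 < i) (hih : i < h) :
    qBinom (wordCoeff b c.toLinearMap v v) h i = 0 := by
  have hγ := diagCoeff_ne_zero htri
  have hex : ∀ l : List ι, ∃ P, IsLyndon l →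
      IsBracket b (opLeft k V) (opRight c.toLinearMap) l P := by
    intro l
    by_cases hl : IsLyndon l
    · obtain ⟨P, hP⟩ := hl.exists_isBracket htri.isTwisted hγ
      exact ⟨P, fun _ => hP⟩
    · exact ⟨0, fun h => absurd h hl⟩
  choose P hP using hex
  choose fac₀ hfac₀ using exists_lyndon_factorization (ι := ι)
  obtain ⟨fac, hfacdef⟩ : ∃ fac, fac = Function.update fac₀ (wordPow v h) (List.replicate h v) :=
    ⟨_, rfl⟩
  have hfacv : fac (wordPow v h) = List.replicate h v := by rw [hfacdef, Function.update_self]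
  have hfac : ∀ w, (fac w).flatten = w ∧ (∀ l ∈ fac w, IsLyndon l) ∧
      (fac w).Pairwise (· ≥ ·) := by
    intro w
    by_cases hw : w = wordPow v h
    · rw [hw, hfacv]
      refine ⟨rfl, fun l hl => by rw [List.eq_of_mem_replicate hl]; exact hv, ?_⟩
      rw [List.pairwise_replicate]
      exact Or.inr le_rfl
    · rw [hfacdef, Function.update_of_ne hw]
      exact hfac₀ w
  have hB : ∀ w, ((fac w).map P).prod - word b w ∈
      wordSpan b fun w' => w'.length = w.length ∧ w < w' := by
    intro w
    have h1 := prod_map_sub_word_mem_wordSpan (b := b) (P := P) (L := fac w) fun l hl =>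
      wordSpan_mono (fun w' h => ⟨h.1.length_eq, h.2⟩) (hP l ((hfac w).2.1 l hl)).sub_word_mem
    rwa [(hfac w).1] at h1
  -- the relation with leading word `v ^ h`
  obtain ⟨u, hu⟩ : ∃ u, u = wordPow v h := ⟨_, rfl⟩
  rw [← hu] at hh hfacv
  obtain ⟨B, hBdef⟩ : ∃ B : List ι → TensorAlgebra k V, B = fun w => ((fac w).map P).prod :=
    ⟨_, rfl⟩
  have hKgt : ∀ w, w.length = u.length → u < w → word b w ∈
      Submodule.span k (B '' {w' | w'.length = u.length ∧ u < w' ∧ IsNormal b I w'}) ⊔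
      (wordSpan b (fun w' => w'.length < u.length) ⊔ I.restrictScalars k) := by
    intro w hw huw
    have h1 := word_mem_span_normal (b := b) (I := I) hB hw
    rw [← hBdef] at h1
    refine (sup_le_sup_right (Submodule.span_mono (Set.image_mono ?_)) _ :
      (_ : Submodule k (TensorAlgebra k V)) ≤ _) h1
    exact fun w' hw' => ⟨hw'.1, huw.trans_le hw'.2.1, hw'.2.2⟩
  have hBu : B u ∈
      Submodule.span k (B '' {w' | w'.length = u.length ∧ u < w' ∧ IsNormal b I w'}) ⊔
      (wordSpan b (fun w' => w'.length < u.length) ⊔ I.restrictScalars k) := by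
    rw [← sub_add_cancel (B u) (word b u)]
    refine add_mem ?_ ?_
    · have h1 := hB u
      rw [hBdef]
      rw [hBdef] at hKgt
      exact wordSpan_le (fun w hw => hKgt w hw.1 hw.2) h1
    · refine sup_le (wordSpan_le fun w hw => ?_) (le_sup_of_le_right le_sup_right)
        (not_not.mp hh)
      rcases hw with h1 | ⟨h1, h2⟩
      · exact Submodule.mem_sup_right (Submodule.mem_sup_left (word_mem_wordSpan h1))
      · exact hKgt w h1.symm h2
  obtain ⟨s, hs, z, hz, hsz⟩ := Submodule.mem_sup.mp hBu
  obtain ⟨l, hl, rfl⟩ := (Finsupp.mem_span_image_iff_linearCombination k).mp hs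
  rw [Finsupp.mem_supported] at hl
  obtain ⟨α, hα⟩ : ∃ α : List ι →₀ k, α = Finsupp.single u 1 - l := ⟨_, rfl⟩
  have hlu : l u = 0 := by
    by_contra hne
    exact lt_irrefl _ (hl (Finsupp.mem_support_iff.mpr hne)).2.1
  have hαu : u ∈ α.support := by
    rw [Finsupp.mem_support_iff, hα]
    simp [hlu]
  have hsupp : ∀ w ∈ α.support, w = u ∨ (w.length = u.length ∧ u < w ∧ IsNormal b I w) := by
    intro w hw
    by_cases hwu : w = u
    · exact Or.inl hwu
    · refine Or.inr (hl (Finsupp.mem_support_iff.mpr fun h0 => ?_))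
      rw [Finsupp.mem_support_iff, hα] at hw
      simp [h0, Ne.symm hwu] at hw
  have hrel : ∑ w ∈ α.support, α w • ((fac w).map P).prod ∈
      wordSpan b (fun w => w.length < u.length) ⊔ I.restrictScalars k := by
    have h1 : Finsupp.linearCombination k B α = z := by
      rw [hα, map_sub, Finsupp.linearCombination_single, one_smul, ← hsz, add_sub_cancel_left]
    rw [← h1, Finsupp.linearCombination_apply, Finsupp.sum, hBdef] at hz
    exact hz
  have hlen : ∀ w ∈ α.support, w.length = u.length := fun w hw =>
    (hsupp w hw).elim (fun h => by rw [h]) fun h => h.1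
  have hnorm (w : List ι) (hw : IsNormal b I w) {y s : List ι} (h : w = y ++ s) :
      IsNormal b I y :=
    IsNormal.of_append hI.isTwoSided (p := []) (s := s) (by rwa [List.nil_append, ← h])
  have key := fun {m : List ι} (hm : IsLyndon m) {i : ℕ} =>
    qBinom_count_eq_zero htri hγ hI hP (fun w => (hfac w).1) (fun w => (hfac w).2.1)
      (fun w => (hfac w).2.2) hlen hrel hm (i := i)
  by_cases hsmall : ∃ w ∈ α.support, ∃ l ∈ fac w, l < v
  · -- the smallest Lyndon factor that occurs cannot be smaller than `v`
    exfalso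
    obtain ⟨w', hw', l', hl', hl'v⟩ := hsmall
    obtain ⟨m, hm, hmmin⟩ := Finset.exists_min_image
      (α.support.biUnion fun w => (fac w).toFinset) id
      ⟨l', Finset.mem_biUnion.mpr ⟨w', hw', List.mem_toFinset.mpr hl'⟩⟩
    obtain ⟨w, hw, hmw⟩ := Finset.mem_biUnion.mp hm
    rw [List.mem_toFinset] at hmw
    have hmin : ∀ w ∈ α.support, ∀ l ∈ fac w, m ≤ l := fun w hw l hl =>
      hmmin l (Finset.mem_biUnion.mpr ⟨w, hw, List.mem_toFinset.mpr hl⟩)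
    have hmv : m < v := (hmin w' hw' l' hl').trans_lt hl'v
    obtain ⟨L, e, h1, h2⟩ := exists_eq_append_replicate (hfac w).2.2 (hmin w hw)
    have hcount := count_eq_of_eq_append_replicate h1 h2
    have hwn : IsNormal b I w := by
      rcases hsupp w hw with rfl | h3
      · rw [hfacv] at hmw
        exact absurd (List.eq_of_mem_replicate hmw) hmv.ne
      · exact h3.2.2
    have hme : IsNormal b I (wordPow m e) := by
      have h3 := (hfac w).1
      rw [h1, List.flatten_append] at h3
      refine IsNormal.of_append hI.isTwoSided (p := L.flatten) (s := []) ?_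
      rw [List.append_nil]
      exact h3.symm ▸ hwn
    have h4 := key ((hfac w).2.1 m hmw) hme hmin (fun w' hw' hcw y hy => ?_) hw
    rotate_left
    · rcases hsupp w' hw' with rfl | h3
      · rw [hfacv, List.count_replicate, if_neg (by simpa using hmv.ne')] at hcw
        exact absurd (hcount ▸ List.count_pos_iff.mpr hmw) (not_lt.mpr hcw)
      · exact hnorm w' h3.2.2 hy
    rw [hcount, qBinom_self] at h4
    exact one_ne_zero h4
  · push Not at hsmall
    have h1 := key hv (hlt i hi hih) hsmall (fun w hw hcw y hy => ?_) hαu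
    rotate_left
    · rcases hsupp w hw with rfl | h3
      · rw [hu, ← Nat.sub_add_cancel hih.le, wordPow_add] at hy
        rw [← List.append_cancel_right hy]
        exact hlt _ (by omega) (by omega)
      · exact hnorm w h3.2.2 hy
    rwa [hfacv, List.count_replicate_self] at h1

end Relation

end BraidedPBW

end

theorem mainTheorem2 {k V ι : Type*} [Field k] [AddCommGroup V] [Module k V]
    [Fintype ι] [LinearOrder ι] (b : Module.Basis ι k V)
    (c : V ⊗[k] V ≃ₗ[k] V ⊗[k] V)
    (hc : BraidedPBW.BraidEquation c.toLinearMap)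
    (htri : BraidedPBW.IsLeftTriangular b c.toLinearMap)
    (I : Ideal (TensorAlgebra k V)) (hI : BraidedPBW.IsBraidedBiideal c.toLinearMap I)
    (hproper : I ≠ ⊤)
    (v : List ι) (hv : v ∈ BraidedPBW.hardWords b I) :
    BraidedPBW.extend (BraidedPBW.diagComponent b c.toLinearMap)
        (BraidedPBW.word b v ⊗ₜ[k] BraidedPBW.word b v) =
      BraidedPBW.wordCoeff b c.toLinearMap v v •
        (BraidedPBW.word b v ⊗ₜ[k] BraidedPBW.word b v) ∧
    (BraidedPBW.height b I v ≠ ⊤ →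
      IsOfFinOrder (BraidedPBW.wordCoeff b c.toLinearMap v v) ∧
      (CharZero k →
        BraidedPBW.wordCoeff b c.toLinearMap v v ≠ 1 ∧
        BraidedPBW.height b I v =
          (orderOf (BraidedPBW.wordCoeff b c.toLinearMap v v) : ℕ∞)) ∧
      (∀ p : ℕ, p.Prime → CharP k p →
        ∃ l : ℕ, BraidedPBW.height b I v =
          ((orderOf (BraidedPBW.wordCoeff b c.toLinearMap v v) * p ^ l : ℕ) : ℕ∞))) := by
  classical
  refine ⟨BraidedPBW.extend_diagComponent_word b _ v v, fun hfin => ?_⟩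
  obtain ⟨q, hq⟩ : ∃ q, q = BraidedPBW.wordCoeff b c.toLinearMap v v := ⟨_, rfl⟩
  have hex : ∃ t, 0 < t ∧ ¬ BraidedPBW.IsNormal b I (BraidedPBW.wordPow v t) := by
    by_contra hcon
    refine hfin ?_
    rw [BraidedPBW.height, show {t : ℕ | 0 < t ∧ _} = ∅ from ?_, Set.image_empty, sInf_empty]
    exact Set.eq_empty_of_forall_notMem fun t ht => hcon ⟨t, ht.1, not_not.mpr ht.2⟩
  obtain ⟨h, hh⟩ : ∃ h, h = Nat.find hex := ⟨_, rfl⟩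
  have hspec := Nat.find_spec hex
  have hmin : ∀ i, 0 < i → i < h → BraidedPBW.IsNormal b I (BraidedPBW.wordPow v i) := by
    intro i hi hih
    by_contra hcon
    exact Nat.find_min hex (hh ▸ hih) ⟨hi, hcon⟩
  rw [← hh] at hspec
  have hheight : BraidedPBW.height b I v = h := by
    refine le_antisymm (sInf_le ⟨h, ⟨hspec.1, not_not.mp hspec.2⟩, rfl⟩) (le_sInf ?_)
    rintro _ ⟨t, ⟨ht, htI⟩, rfl⟩
    rw [Nat.cast_le, hh]
    exact Nat.find_min' hex ⟨ht, not_not.mpr htI⟩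
  have h1 : 1 < h := by
    refine lt_of_le_of_ne hspec.1 ?_
    rintro rfl
    refine hspec.2 ?_
    rw [BraidedPBW.wordPow_one]
    exact hv.2
  have hbinom : ∀ i, 0 < i → i < h → BraidedPBW.qBinom q h i = 0 := fun i hi hih => by
    rw [hq]
    exact BraidedPBW.qBinom_eq_zero_of_height htri hI hv.1 hspec.2 hmin hi hih
  rw [hheight, ← hq]
  refine ⟨(BraidedPBW.exists_mul_orderOf_of_qBinom_eq_zero h1 hbinom).1, fun hchar => ?_,
    fun p hp hchar => ?_⟩
  · obtain ⟨h2, h3⟩ := BraidedPBW.orderOf_eq_of_qBinom_eq_zero h1 hbinom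
    exact ⟨h2, congrArg _ h3⟩
  · obtain ⟨l, hl⟩ := BraidedPBW.exists_eq_orderOf_mul_pow_of_qBinom_eq_zero hp h1 hbinom
    exact ⟨l, congrArg _ hl⟩
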